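/- **Setting.** Let $\mathcal X$ be a measurable space, $\mu$ a probability measure on $\mathcal X\times\{-1,+1\}$, and $\mathcal H$ a class of measurable functions $h:\mathcal X\to\{-1,+1\}$ of finite VC dimension $\mathcal V(\mathcal H)$; as usual for uncountable classes, assume that $\mathcal H$ has a countable subclass such that every $h\in\mathcal H$ is the pointwise limit of a sequence from it. Let $\Lambda=\ell^1(\mathcal H)$ be the space of absolutely summable weightings $\lambda:\mathcal H\to\mathbb R$, let $\mathbf e_h\in\Lambda$ be the unit weight on $h$, and put $(H\lambda)_x=\sum_{h}h(x)\lambda(h)$ and $(A\lambda)_{x,y}=-y(H\lambda)_x$. Let $\ell:\mathbb R\to[0,\infty)$ be convex and differentiable, with tightest Lipschitz constant $\beta_2$, with $\ell'\in[0,\beta_2]$ everywhere and $\ell'\in[\beta_1,\beta_2]$ on $[0,\infty)$, where $0<\beta_1\le\beta_2$, and such that $\ell'$ is Lipschitz with tightest constant $B_2<\infty$. Put $$\bar{\mathcal L}=\inf_{\lambda\in\Lambda}\int\ell(A\lambda)\,d\mu,\qquad \mathcal R(H\lambda)=\int\big(\mathbf 1[y=+1\wedge(H\lambda)_x<0]+\mathbf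 1[y=-1\wedge(H\lambda)_x\ge0]\big)d\mu(x,y),$$ $$\gamma_\epsilon(\mu)=\inf_{p\in\mathcal D_\epsilon(\mu)}\ \sup_{\lambda\in\Lambda,\ \|\lambda\|_1\le1}\Big(-\int(A\lambda)\,p\,d\mu\Big),\qquad \mathcal D_\epsilon(\mu)=\{p\in L^1(\mu):p\ge0\text{ a.e.},\ \|p\|_1=1,\ \|p\|_\infty\le1/\epsilon\}.$$ **Algorithm.** Given a sample $(x_i,y_i)_{i=1}^m$ and $a,\rho\in(0,1)$, write $\hat{\mathcal L}(\lambda)=\frac1m\sum_i\ell((A\lambda)_{x_i,y_i})$, $\hat g(\lambda,v)=\frac1m\sum_i\ell'((A\lambda)_{x_i,y_i})(Av)_{x_i,y_i}$, $\hat G(\lambda)=\sup_{h\in\mathcal H}|\hat g(\lambda,\mathbf e_h)|$, and let $\hat{\mathcal R}$ be the empirical version of $\mathcal R$. Start from $\lambda_0=0$. For $t=1,\dots,\lceil m^a\rceil$ choose any $h_t\in\mathcal H$ with $|\hat g(\lambda_{t-1},\mathbf e_{h_t})|\ge\rho\,\hat G(\lambda_{t-1})$ and $v_t\in\{\pm\mathbf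 e_{h_t}\}$ with $-\hat G(\lambda_{t-1})\le\hat g(\lambda_{t-1},v_t)\le-\rho\,\hat G(\lambda_{t-1})$, and set $\lambda_t=\lambda_{t-1}+\alpha_tv_t$. Here a step is optimal if it minimizes $\alpha\mapsto\hat{\mathcal L}(\lambda_{t-1}+\alpha v_t)$ over $\alpha\ge0$, and $\alpha_t$ is any of the following: (1) an optimal step; (2) a number $\alpha_t\ge-\hat g(\lambda_{t-1},v_t)/B_2$ that is smaller than some optimal step, or any such number if no optimal step exists; (3) an $\alpha_t\ge0$ satisfying the Wolfe conditions $\hat{\mathcal L}(\lambda_t)\le\hat{\mathcal L}(\lambda_{t-1})+\tfrac13\alpha_t\,\hat g(\lambda_{t-1},v_t)$ and $\hat g(\lambda_t,v_t)\ge\tfrac12\hat g(\lambda_{t-1},v_t)$. Return $\hat\lambda\in\{\lambda_1,\dots,\lambda_{\lceil m^a\rceil}\}$ with the least $\hat{\mathcal R}$ among these iterates. **Theorem.** Suppose $\bar{\mathcal L}=0$, let $\epsilon,\delta\in(0,1]$, and put $\epsilon'=\epsilon\beta_1/\beta_2$. Then $\gamma_{\epsilon'}(\mu)>0$. If moreover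 $$m\ \ge\ \max\Big\{\frac{2}{(\epsilon\gamma_{\epsilon'}(\mu))^2}\ln\Big(\frac4\delta\Big),\ \Big(\frac{24B_2\,\ell(0)}{(\rho\beta_1\epsilon\gamma_{\epsilon'}(\mu))^2}\Big)^{1/a}\Big\},$$ then with probability at least $1-\delta$ over an i.i.d. sample of size $m$ from $\mu$, every possible output $\hat\lambda$ of the algorithm satisfies $$\mathcal R(H\hat\lambda)\ \le\ \epsilon+2\sqrt{\epsilon\,\frac{(\mathcal V(\mathcal H)+1)\ln(2em)+\ln(8/\delta)}{m^{1-a}}}+4\,\frac{(\mathcal V(\mathcal H)+1)\ln(2em)+\ln(8/\delta)}{m^{1-a}}.$$ -/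

import Mathlib

open MeasureTheory

namespace Boosting

noncomputable section

/-- Labels: `true` stands for `+1` and `false` for `-1`. -/
def label (y : Bool) : ℝ := if y then 1 else -1

/-- Absolutely summable weightings of the class `H`, i.e. `L¹` of the counting measure on `H`. -/
abbrev Weighting {X : Type*} (H : Set (X → ℝ)) : Type _ := ↥(lp (fun _ : ↥H => ℝ) 1)

/-- The voted predictor `(H w)(x) = ∑ h, h x * w h`. -/
def vote {X : Type*} {H : Set (X → ℝ)} (w : Weighting H) (x : X) : ℝ :=
  ∑' h : ↥H, h.1 x * w h

/-- The negated margin `(A w)(x, y) = -y (H w)(x)`. -/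
def negMargin {X : Type*} {H : Set (X → ℝ)} (w : Weighting H) (z : X × Bool) : ℝ :=
  -label z.2 * vote w z.1

open Classical in
/-- The weighting with unit weight on `h` and zero weight elsewhere. -/
def unitWeight {X : Type*} {H : Set (X → ℝ)} (h : ↥H) : Weighting H :=
  lp.single 1 h (1 : ℝ)

/-! ### The class -/

/-- The finite set `s` is shattered by the class `H` of `{-1, +1}`-valued functions. -/
def Shatters {X : Type*} (H : Set (X → ℝ)) (s : Finset X) : Prop :=
  ∀ t ⊆ s, ∃ h ∈ H, ∀ x ∈ s, (h x = 1 ↔ x ∈ t)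

/-- The VC dimension of a class of `{-1, +1}`-valued functions. -/
def vcDim {X : Type*} (H : Set (X → ℝ)) : ℕ∞ :=
  ⨆ s : Finset X, ⨆ _ : Shatters H s, (s.card : ℕ∞)

/-- The usual regularity of classes indexed by an uncountable set: `H` has a countable subclass
from which each member of `H` is obtained as a pointwise limit of a sequence. -/
def PointwiseSeparable {X : Type*} (H : Set (X → ℝ)) : Prop :=
  ∃ H₀ ⊆ H, H₀.Countable ∧ ∀ h ∈ H, ∃ u : ℕ → X → ℝ, (∀ n, u n ∈ H₀) ∧
    ∀ x, Filter.Tendsto (fun n => u n x) Filter.atTop (nhds (h x))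

/-! ### The loss -/

/-- Differentiable convex Lipschitz losses with slopes in `[0, β₂]` everywhere and in `[β₁, β₂]`
on the nonnegative reals, with tightest Lipschitz constant `β₂` and tightest Lipschitz constant
`B₂` of the derivative. -/
structure IsBdsLoss (ℓ : ℝ → ℝ) (β₁ β₂ B₂ : ℝ) : Prop where
  nonneg : ∀ x, 0 ≤ ℓ x
  convex : ConvexOn ℝ Set.univ ℓ
  differentiable : Differentiable ℝ ℓ
  lipschitz : IsLUB {r : ℝ | ∃ x y : ℝ, x ≠ y ∧ r = |ℓ x - ℓ y| / |x - y|} β₂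
  deriv_mem : ∀ x, deriv ℓ x ∈ Set.Icc 0 β₂
  beta_pos : 0 < β₁
  beta_le : β₁ ≤ β₂
  deriv_mem_of_nonneg : ∀ x, 0 ≤ x → deriv ℓ x ∈ Set.Icc β₁ β₂
  deriv_lipschitz :
    IsLUB {r : ℝ | ∃ x y : ℝ, x ≠ y ∧ r = (deriv ℓ y - deriv ℓ x) / (y - x)} B₂

/-! ### Quantities of the source distribution -/

/-- The optimal surrogate risk `inf_w ∫ ℓ(A w) dμ`. -/
def optSurrogateRisk {X : Type*} [MeasurableSpace X] (ℓ : ℝ → ℝ) (H : Set (X → ℝ))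
    (μ : Measure (X × Bool)) : ℝ :=
  ⨅ w : Weighting H, ∫ z, ℓ (negMargin w z) ∂μ

/-- `1` if the real prediction `v`, thresholded at `0`, misclassifies the label `y`, else `0`. -/
def zeroOne (v : ℝ) (y : Bool) : ℝ :=
  (if y = true ∧ v < 0 then 1 else 0) + (if y = false ∧ 0 ≤ v then 1 else 0)

/-- The classification risk of `H w`. -/
def risk {X : Type*} [MeasurableSpace X] {H : Set (X → ℝ)} (μ : Measure (X × Bool))
    (w : Weighting H) : ℝ :=
  ∫ z, zeroOne (vote w z.1) z.2 ∂μ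

/-- Densities with respect to `ν` bounded by `1 / ε`, where `1 / 0 = ∞`. -/
def densities {Z : Type*} [MeasurableSpace Z] (ε : ℝ) (ν : Measure Z) : Set (Z → ℝ) :=
  {p | MemLp p 1 ν ∧ 0 ≤ᵐ[ν] p ∧ eLpNorm p 1 ν = 1 ∧ eLpNorm p ⊤ ν ≤ (ENNReal.ofReal ε)⁻¹}

/-- `γ_ε(ν)`: the infimum over densities `p` bounded by `1 / ε` of the supremum over weightings
`w` of norm at most one of `-∫ (A w) p dν`. -/
def gam {X : Type*} [MeasurableSpace X] (H : Set (X → ℝ)) (ε : ℝ)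
    (ν : Measure (X × Bool)) : ℝ :=
  ⨅ p : ↥(densities ε ν), ⨆ w : {w : Weighting H // ‖w‖ ≤ 1},
    -∫ z, negMargin w.1 z * p.1 z ∂ν

/-! ### Quantities of a sample -/

section Sample

variable {X : Type*} {H : Set (X → ℝ)} {m : ℕ}

/-- The empirical surrogate risk. -/
def empSurrogateRisk (ℓ : ℝ → ℝ) (S : Fin m → X × Bool) (w : Weighting H) : ℝ :=
  (1 / (m : ℝ)) * ∑ i, ℓ (negMargin w (S i))

/-- The empirical classification risk. -/
def empRisk (S : Fin m → X × Bool) (w : Weighting H) : ℝ :=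
  (1 / (m : ℝ)) * ∑ i, zeroOne (vote w (S i).1) (S i).2

/-- The derivative of the empirical surrogate risk at `w` in the direction `v`. -/
def slope (ℓ : ℝ → ℝ) (S : Fin m → X × Bool) (w v : Weighting H) : ℝ :=
  (1 / (m : ℝ)) * ∑ i, deriv ℓ (negMargin w (S i)) * negMargin v (S i)

/-- The supremum over `h` in `H` of the absolute slopes at `w` in the coordinate directions. -/
def maxSlope (ℓ : ℝ → ℝ) (S : Fin m → X × Bool) (w : Weighting H) : ℝ :=
  ⨆ h : ↥H, |slope ℓ S w (unitWeight h)|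

/-! ### The algorithm -/

/-- `α` is an optimal unconstrained step from `w` in the direction `v`.  The step `0` is
optimal only if `v` is not a descent direction. -/
def IsOptimalStep (ℓ : ℝ → ℝ) (S : Fin m → X × Bool) (w v : Weighting H) (α : ℝ) : Prop :=
  0 ≤ α ∧ ∀ α' : ℝ, 0 ≤ α' →
    empSurrogateRisk ℓ S (w + α • v) ≤ empSurrogateRisk ℓ S (w + α' • v)

/-- A step at least as large as the minimizer of the quadratic upper bound, and smaller than an
optimal step (any such step, if there is no optimal one). -/
def IsShortStep (ℓ : ℝ → ℝ) (B₂ : ℝ) (S : Fin m → X × Bool) (w v : Weighting H) (α : ℝ) :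
    Prop :=
  -slope ℓ S w v / B₂ ≤ α ∧
    ((∃ α' : ℝ, IsOptimalStep ℓ S w v α' ∧ α < α') ∨ ¬ ∃ α' : ℝ, IsOptimalStep ℓ S w v α')

/-- The Wolfe conditions, with constants `1 / 3` and `1 / 2`. -/
def IsWolfeStep (ℓ : ℝ → ℝ) (S : Fin m → X × Bool) (w v : Weighting H) (α : ℝ) : Prop :=
  0 ≤ α ∧
    empSurrogateRisk ℓ S (w + α • v) ≤ empSurrogateRisk ℓ S w + α * (1 / 3) * slope ℓ S w v ∧
    (1 / 2) * slope ℓ S w v ≤ slope ℓ S (w + α • v) v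

/-- `w'` may follow `w` in one iteration of the algorithm. -/
def IsBoostStep (ℓ : ℝ → ℝ) (B₂ ρ : ℝ) (S : Fin m → X × Bool) (w w' : Weighting H) : Prop :=
  ∃ (h : ↥H) (v : Weighting H) (α : ℝ),
    ρ * maxSlope ℓ S w ≤ |slope ℓ S w (unitWeight h)| ∧
    (v = unitWeight h ∨ v = -unitWeight h) ∧
    slope ℓ S w v ≤ -ρ * maxSlope ℓ S w ∧
    -maxSlope ℓ S w ≤ slope ℓ S w v ∧
    (IsOptimalStep ℓ S w v α ∨ IsShortStep ℓ B₂ S w v α ∨ IsWolfeStep ℓ S w v α) ∧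
    w' = w + α • v

/-- `w` is a possible output of the algorithm on the sample `S`: run `⌈m ^ a⌉` iterations from
`0`, and return one of the iterates `1, …, ⌈m ^ a⌉` with least empirical classification risk. -/
def IsBoostOutput (ℓ : ℝ → ℝ) (B₂ ρ a : ℝ) (S : Fin m → X × Bool) (w : Weighting H) : Prop :=
  ∃ it : ℕ → Weighting H,
    it 0 = 0 ∧
    (∀ t < ⌈(m : ℝ) ^ a⌉₊, IsBoostStep ℓ B₂ ρ S (it t) (it (t + 1))) ∧
    ∃ i ∈ Finset.Icc 1 ⌈(m : ℝ) ^ a⌉₊,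
      (∀ j ∈ Finset.Icc 1 ⌈(m : ℝ) ^ a⌉₊, empRisk S (it i) ≤ empRisk S (it j)) ∧ w = it i

end Sample

end

end Boosting

/-!
The argument has an optimization half and a statistical half, which meet in the choice of a single
event of probability at least `1 - δ`.

*Margins.*  A weighting of small surrogate risk has, by the tangent of the loss at `0`, a large
average margin under every density bounded by `β₂ / (ε * β₁)`, whence `γ > 0` (`gam_pos`).  By a
minimax argument (`exists_comparator`, through a smoothed tail average) one weighting `v` of norm
at most one is good against all these densities at once: for some level `b` the shortfalls
`u = (b + A v)₊` satisfy `∫ u ≤ ε * β₁ / β₂ * (b - g)`, with `g` as close to `γ` as desired.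

*Optimization.*  If an iterate misclassifies a fraction `ε` of the sample, the weights
`ℓ' / β₁` at the sample points have mean at least `ε`, maximum at most `β₂ / β₁`, and mean square
at most `2 * B₂ * ℓ 0 / β₁ ^ 2`, because `ℓ' ^ 2 ≤ 2 * B₂ * ℓ` and the empirical surrogate risk
never increases.  On the event that `u` has a sample mean not much above its expectation, the
weighted margin of `v` is then at least `ε * γ / 2` (`weighted_margin_ge`), so the largest slope
is at least `β₁ * ε * γ / 2`.  Since each step lowers the empirical surrogate risk by a multiple of
the squared slope (`IsBoostStep.descent`), this cannot happen for `⌈m ^ a⌉` iterations, and the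
output has empirical classification risk at most `ε` (`IsBoostOutput.empRisk_le`).

The maximum `β₂ / β₁` of the weights does not enter the hypothesis on `m`.  What makes the sample
large enough for `weighted_margin_ge` is that the claimed bound is at least `1` unless
`m ^ (1 - a) > 4 * ((V + 1) * log (2 * e * m) + log (8 / δ))`; together with
`m ^ a ≥ 24 * B₂ * ℓ 0 / (ρ * β₁ * ε * γ) ^ 2` this gives the required size in terms of the
mean square of the weights.

*Statistics.*  The output is a weighted vote of `⌈m ^ a⌉` members of the class.  On `5 * m` points
the error sets of such votes have at most `(5 * m + 1) ^ ((V + 1) * ⌈m ^ a⌉)` traces, by the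
Sauer–Shelah lemma for the class and for half-spaces (`card_traces_errorSets_le`).
Symmetrization with a ghost sample of size `4 * m` (`measure_exists_deviation_le`) bounds the
probability that a vote of empirical risk at most `ε` has a risk above the bound.  With a ghost
sample of size `m` the exponent would be just short of what is needed, because `⌈m ^ a⌉` may exceed
`m ^ a`; the larger ghost sample improves it by a constant factor that absorbs the rounding.
-/

namespace Boosting

/-! ### The voted predictor as a linear function of the weighting -/

section Vote

variable {X : Type*} {H : Set (X → ℝ)}

lemma abs_le_one_of_binary (hbin : ∀ h ∈ H, ∀ x, h x = 1 ∨ h x = -1) (h : ↥H) (x : X) :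
    |h.1 x| ≤ 1 := by
  rcases hbin h.1 h.2 x with e | e <;> simp [e]

lemma abs_label (y : Bool) : |label y| = 1 := by cases y <;> simp [label]

lemma summable_abs_weighting (w : Weighting H) : Summable fun h : ↥H => |w h| := by
  have := (lp.memℓp w).summable (by norm_num)
  simpa using this

lemma norm_weighting_eq_tsum (w : Weighting H) : ‖w‖ = ∑' h : ↥H, |w h| := by
  rw [lp.norm_eq_tsum_rpow (by norm_num)]
  simp

lemma summable_vote (hbin : ∀ h ∈ H, ∀ x, h x = 1 ∨ h x = -1) (w : Weighting H) (x : X) :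
    Summable fun h : ↥H => h.1 x * w h := by
  refine Summable.of_norm_bounded (summable_abs_weighting w) fun h => ?_
  rw [Real.norm_eq_abs, abs_mul]
  exact mul_le_of_le_one_left (abs_nonneg _) (abs_le_one_of_binary hbin h x)

lemma vote_add (hbin : ∀ h ∈ H, ∀ x, h x = 1 ∨ h x = -1) (w v : Weighting H) (x : X) :
    vote (w + v) x = vote w x + vote v x := by
  rw [vote, vote, vote, ← (summable_vote hbin w x).tsum_add (summable_vote hbin v x)]
  exact tsum_congr fun h => by simp [mul_add]

lemma vote_smul (c : ℝ) (w : Weighting H) (x : X) : vote (c • w) x = c * vote w x := by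
  rw [vote, vote, ← tsum_mul_left]
  exact tsum_congr fun h => by simp; ring

lemma abs_vote_le (hbin : ∀ h ∈ H, ∀ x, h x = 1 ∨ h x = -1) (w : Weighting H) (x : X) :
    |vote w x| ≤ ‖w‖ := by
  rw [norm_weighting_eq_tsum, ← Real.norm_eq_abs]
  refine tsum_of_norm_bounded (summable_abs_weighting w).hasSum fun h => ?_
  rw [Real.norm_eq_abs, abs_mul]
  exact mul_le_of_le_one_left (abs_nonneg _) (abs_le_one_of_binary hbin h x)

lemma vote_unitWeight (h : ↥H) (x : X) : vote (unitWeight h) x = h.1 x := by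
  classical
  rw [vote, tsum_eq_single h]
  · simp [unitWeight]
  · intro h' hne
    simp [unitWeight, hne]

lemma negMargin_add (hbin : ∀ h ∈ H, ∀ x, h x = 1 ∨ h x = -1) (w v : Weighting H)
    (z : X × Bool) : negMargin (w + v) z = negMargin w z + negMargin v z := by
  simp only [negMargin, vote_add hbin]; ring

lemma negMargin_smul (c : ℝ) (w : Weighting H) (z : X × Bool) :
    negMargin (c • w) z = c * negMargin w z := by
  simp only [negMargin, vote_smul]; ring

lemma negMargin_neg (w : Weighting H) (z : X × Bool) : negMargin (-w) z = -negMargin w z := by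
  have := negMargin_smul (-1) w z
  simpa using this

lemma negMargin_zero (z : X × Bool) : negMargin (0 : Weighting H) z = 0 := by
  have := negMargin_smul 0 (0 : Weighting H) z
  simpa using this

lemma abs_negMargin_le (hbin : ∀ h ∈ H, ∀ x, h x = 1 ∨ h x = -1) (w : Weighting H)
    (z : X × Bool) : |negMargin w z| ≤ ‖w‖ := by
  rw [negMargin, abs_mul, abs_neg, abs_label, one_mul]
  exact abs_vote_le hbin w z.1

lemma sq_negMargin_unitWeight (hbin : ∀ h ∈ H, ∀ x, h x = 1 ∨ h x = -1) (h : ↥H)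
    {v : Weighting H} (hv : v = unitWeight h ∨ v = -unitWeight h) (z : X × Bool) :
    negMargin v z ^ 2 = 1 := by
  have key : negMargin (unitWeight h) z ^ 2 = 1 := by
    rw [negMargin, vote_unitWeight]
    rcases hbin h.1 h.2 z.1 with e | e <;> cases z.2 <;> simp [e, label]
  rcases hv with rfl | rfl
  · exact key
  · rw [negMargin_neg, neg_sq, key]

/-- Only countably many coordinates of a summable weighting are nonzero, so its vote is a
countable sum of measurable functions even though the class may be uncountable. -/
lemma measurable_vote [MeasurableSpace X] (hmeas : ∀ h ∈ H, Measurable h) (w : Weighting H) :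
    Measurable fun x => vote w x := by
  have hc : (Function.support fun h : ↥H => |w h|).Countable :=
    (summable_abs_weighting w).countable_support
  have e : (fun x => vote w x) =
      fun x => ∑' h : ↥(Function.support fun h : ↥H => |w h|), h.1.1 x * w h.1 := by
    funext x
    refine (tsum_subtype_eq_of_support_subset (f := fun h : ↥H => h.1 x * w h) ?_).symm
    intro h hh
    simp only [Function.mem_support, ne_eq, mul_eq_zero, not_or, abs_eq_zero] at hh ⊢
    exact hh.2
  have : Countable ↥(Function.support fun h : ↥H => |w h|) := hc.to_subtype
  rw [e]
  refine Measurable.tsum (fun h => (hmeas h.1.1 h.1.2).mul_const _)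

lemma measurable_label : Measurable label := measurable_from_top

lemma measurable_negMargin [MeasurableSpace X] (hmeas : ∀ h ∈ H, Measurable h) (w : Weighting H) : Measurable fun z => negMargin w z :=
  (measurable_label.comp measurable_snd).neg.mul
    ((measurable_vote hmeas w).comp measurable_fst)

lemma zeroOne_le_one (v : ℝ) (y : Bool) : zeroOne v y ≤ 1 := by
  unfold zeroOne; cases y <;> simp <;> split_ifs <;> norm_num

/-- A misclassified point has a nonnegative negated margin. -/
lemma negMargin_nonneg_of_zeroOne_ne_zero (w : Weighting H) (z : X × Bool)
    (h : zeroOne (vote w z.1) z.2 ≠ 0) : 0 ≤ negMargin w z := by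
  obtain ⟨x, y⟩ := z
  cases y
  · have : 0 ≤ vote w x := by
      by_contra hc
      exact h (by simp [zeroOne, hc])
    simpa [negMargin, label] using this
  · have : vote w x < 0 := by
      by_contra hc
      exact h (by simp [zeroOne, hc])
    simpa [negMargin, label] using this.le

end Vote

/-! ### Elementary properties of the loss -/

namespace IsBdsLoss

variable {ℓ : ℝ → ℝ} {β₁ β₂ B₂ : ℝ}

lemma deriv_sub_le (hℓ : IsBdsLoss ℓ β₁ β₂ B₂) {x y : ℝ} (hxy : x ≤ y) :
    deriv ℓ y - deriv ℓ x ≤ B₂ * (y - x) := by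
  rcases hxy.eq_or_lt with rfl | h
  · simp
  · exact (div_le_iff₀ (sub_pos.2 h)).1 (hℓ.deriv_lipschitz.1 ⟨x, y, h.ne, rfl⟩)

lemma tangent_le (hℓ : IsBdsLoss ℓ β₁ β₂ B₂) (x y : ℝ) :
    ℓ x + deriv ℓ x * (y - x) ≤ ℓ y := by
  rcases lt_trichotomy x y with h | rfl | h
  · have := hℓ.convex.deriv_le_slope (Set.mem_univ x) (Set.mem_univ y) h (hℓ.differentiable x)
    rw [slope_def_field, le_div_iff₀ (sub_pos.2 h)] at this
    linarith
  · simp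
  · have := hℓ.convex.slope_le_deriv (Set.mem_univ y) (Set.mem_univ x) h (hℓ.differentiable x)
    rw [slope_def_field, div_le_iff₀ (sub_pos.2 h)] at this
    linarith

lemma continuous (hℓ : IsBdsLoss ℓ β₁ β₂ B₂) : Continuous ℓ := hℓ.differentiable.continuous

lemma mono (hℓ : IsBdsLoss ℓ β₁ β₂ B₂) : Monotone ℓ :=
  monotone_of_deriv_nonneg hℓ.differentiable fun x => (hℓ.deriv_mem x).1

/-- The quadratic upper bound given by the Lipschitz derivative. -/
lemma le_quadratic (hℓ : IsBdsLoss ℓ β₁ β₂ B₂) (x h : ℝ) :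
    ℓ (x + h) ≤ ℓ x + deriv ℓ x * h + B₂ / 2 * h ^ 2 := by
  set g : ℝ → ℝ := fun h => ℓ x + deriv ℓ x * h + B₂ / 2 * h ^ 2 - ℓ (x + h) with hg
  have hd : ∀ h, HasDerivAt g (deriv ℓ x + B₂ * h - deriv ℓ (x + h)) h := by
    intro h
    have h1 : HasDerivAt (fun h : ℝ => ℓ (x + h)) (deriv ℓ (x + h)) h :=
      (hℓ.differentiable (x + h)).hasDerivAt.comp_const_add x h
    have h2 : HasDerivAt (fun h : ℝ => ℓ x + deriv ℓ x * h + B₂ / 2 * h ^ 2)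
        (deriv ℓ x + B₂ * h) h := by
      have := (((hasDerivAt_id h).const_mul (deriv ℓ x)).const_add (ℓ x)).add
        (((hasDerivAt_id h).pow 2).const_mul (B₂ / 2))
      refine this.congr_deriv ?_
      simp only [id_eq, Nat.cast_ofNat]; ring
    exact h2.sub h1
  have hc : Continuous g := continuous_iff_continuousAt.2 fun h => (hd h).continuousAt
  have g0 : g 0 = 0 := by simp [hg]
  suffices 0 ≤ g h by simp only [hg] at this; linarith
  rcases le_total 0 h with h0 | h0
  · have : MonotoneOn g (Set.Ici 0) := by
      refine monotoneOn_of_deriv_nonneg (convex_Ici 0) hc.continuousOn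
        (fun y _ => (hd y).differentiableAt.differentiableWithinAt) fun y hy => ?_
      rw [interior_Ici] at hy
      rw [(hd y).deriv]
      have := hℓ.deriv_sub_le (x := x) (y := x + y) (by linarith [hy.out])
      linarith
    rw [← g0]; exact this Set.self_mem_Ici h0 h0
  · have : AntitoneOn g (Set.Iic 0) := by
      refine antitoneOn_of_deriv_nonpos (convex_Iic 0) hc.continuousOn
        (fun y _ => (hd y).differentiableAt.differentiableWithinAt) fun y hy => ?_
      rw [interior_Iic] at hy
      rw [(hd y).deriv]
      have := hℓ.deriv_sub_le (x := x + y) (y := x) (by linarith [hy.out])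
      linarith
    rw [← g0]; exact this h0 Set.self_mem_Iic h0

lemma deriv_pos_zero (hℓ : IsBdsLoss ℓ β₁ β₂ B₂) : 0 < deriv ℓ 0 :=
  hℓ.beta_pos.trans_le (hℓ.deriv_mem_of_nonneg 0 le_rfl).1

lemma smoothness_pos (hℓ : IsBdsLoss ℓ β₁ β₂ B₂) : 0 < B₂ := by
  -- otherwise the quadratic upper bound is affine with positive slope, hence somewhere negative
  by_contra hB
  have h := hℓ.le_quadratic 0 (-(ℓ 0 + 1) / deriv ℓ 0)
  have h1 := hℓ.nonneg (0 + -(ℓ 0 + 1) / deriv ℓ 0)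
  rw [mul_div_cancel₀ _ hℓ.deriv_pos_zero.ne'] at h
  have h2 := mul_nonneg (by linarith : 0 ≤ -(B₂ / 2)) (sq_nonneg (-(ℓ 0 + 1) / deriv ℓ 0))
  linarith

/-- The derivative is bounded by the loss itself: minimize the quadratic upper bound of the
nonnegative function `ℓ`. -/
lemma sq_deriv_le (hℓ : IsBdsLoss ℓ β₁ β₂ B₂) (x : ℝ) : deriv ℓ x ^ 2 ≤ 2 * B₂ * ℓ x := by
  have hB := hℓ.smoothness_pos
  have h := hℓ.le_quadratic x (-deriv ℓ x / B₂)
  have h1 := hℓ.nonneg (x + -deriv ℓ x / B₂)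
  have e : deriv ℓ x * (-deriv ℓ x / B₂) + B₂ / 2 * (-deriv ℓ x / B₂) ^ 2
      = -(deriv ℓ x ^ 2 / (2 * B₂)) := by field_simp; ring
  have h2 : deriv ℓ x ^ 2 / (2 * B₂) ≤ ℓ x := by linarith
  rw [div_le_iff₀ (by positivity)] at h2
  linarith

lemma pos_zero (hℓ : IsBdsLoss ℓ β₁ β₂ B₂) : 0 < ℓ 0 := by
  have h := hℓ.sq_deriv_le 0
  have h1 := hℓ.deriv_pos_zero
  have hB := hℓ.smoothness_pos
  by_contra hc
  have : 0 < deriv ℓ 0 ^ 2 := by positivity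
  have : 2 * B₂ * ℓ 0 ≤ 0 := mul_nonpos_of_nonneg_of_nonpos (by positivity) (not_lt.1 hc)
  linarith

end IsBdsLoss

/-! ### Descent of the empirical surrogate risk -/

section Descent

variable {X : Type*} {H : Set (X → ℝ)} {m : ℕ} {ℓ : ℝ → ℝ} {β₁ β₂ B₂ : ℝ}

lemma mean_const_le_one (m : ℕ) : (1 / (m : ℝ)) * ∑ _i : Fin m, (1 : ℝ) ≤ 1 := by
  simp only [Finset.sum_const, Finset.card_univ, Fintype.card_fin, nsmul_eq_mul, mul_one]
  rcases Nat.eq_zero_or_pos m with rfl | hm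
  · simp
  · rw [one_div, inv_mul_cancel₀ (by positivity)]

lemma mean_mono {f g : Fin m → ℝ} (h : ∀ i, f i ≤ g i) :
    (1 / (m : ℝ)) * ∑ i, f i ≤ (1 / (m : ℝ)) * ∑ i, g i :=
  mul_le_mul_of_nonneg_left (Finset.sum_le_sum fun i _ => h i) (by positivity)

lemma abs_slope_unitWeight_le (hbin : ∀ h ∈ H, ∀ x, h x = 1 ∨ h x = -1)
    (hℓ : IsBdsLoss ℓ β₁ β₂ B₂) (S : Fin m → X × Bool) (w : Weighting H) (h : ↥H) :
    |slope ℓ S w (unitWeight h)| ≤ β₂ := by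
  have hβ : 0 ≤ β₂ := hℓ.beta_pos.le.trans hℓ.beta_le
  rw [slope, abs_mul, abs_of_nonneg (by positivity : (0 : ℝ) ≤ 1 / m)]
  calc (1 / (m : ℝ)) * |∑ i, deriv ℓ (negMargin w (S i)) * negMargin (unitWeight h) (S i)|
      ≤ (1 / (m : ℝ)) * ∑ i : Fin m, β₂ * 1 := by
        refine mul_le_mul_of_nonneg_left ((Finset.abs_sum_le_sum_abs _ _).trans
          (Finset.sum_le_sum fun i _ => ?_)) (by positivity)
        have h1 := sq_negMargin_unitWeight hbin h (Or.inl rfl) (S i)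
        have h2 : |negMargin (unitWeight h) (S i)| = 1 := by
          rw [← sq_abs] at h1
          exact (pow_eq_one_iff_of_nonneg (abs_nonneg _) two_ne_zero).1 h1
        rw [abs_mul, h2, abs_of_nonneg (hℓ.deriv_mem _).1]
        exact mul_le_mul_of_nonneg_right (hℓ.deriv_mem _).2 zero_le_one
    _ = β₂ * ((1 / (m : ℝ)) * ∑ i : Fin m, 1) := by rw [← Finset.mul_sum]; ring
    _ ≤ β₂ := mul_le_of_le_one_right hβ (mean_const_le_one m)

lemma bddAbove_abs_slope (hbin : ∀ h ∈ H, ∀ x, h x = 1 ∨ h x = -1)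
    (hℓ : IsBdsLoss ℓ β₁ β₂ B₂) (S : Fin m → X × Bool) (w : Weighting H) :
    BddAbove (Set.range fun h : ↥H => |slope ℓ S w (unitWeight h)|) :=
  ⟨β₂, by rintro _ ⟨h, rfl⟩; exact abs_slope_unitWeight_le hbin hℓ S w h⟩

lemma maxSlope_nonneg (S : Fin m → X × Bool) (w : Weighting H) : 0 ≤ maxSlope ℓ S w :=
  Real.iSup_nonneg fun _ => abs_nonneg _

/-- The slope is linear in its direction, so over the unit ball of `ℓ¹` its absolute value is
controlled by the coordinate directions. -/
lemma neg_slope_le (hbin : ∀ h ∈ H, ∀ x, h x = 1 ∨ h x = -1)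
    (hℓ : IsBdsLoss ℓ β₁ β₂ B₂) (S : Fin m → X × Bool) (w v : Weighting H) (hv : ‖v‖ ≤ 1) :
    -slope ℓ S w v ≤ maxSlope ℓ S w := by
  have e : HasSum (fun h : ↥H => v h * slope ℓ S w (unitWeight h)) (slope ℓ S w v) := by
    have h1 : ∀ i, HasSum (fun h : ↥H => deriv ℓ (negMargin w (S i)) *
        (-label (S i).2 * (h.1 (S i).1 * v h)))
        (deriv ℓ (negMargin w (S i)) * negMargin v (S i)) := fun i =>
      (((summable_vote hbin v (S i).1).hasSum).mul_left _).mul_left _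
    have h2 := (hasSum_sum (s := Finset.univ) fun i _ => h1 i).mul_left (1 / (m : ℝ))
    refine h2.congr_fun fun h => ?_
    simp only [slope, negMargin, vote_unitWeight, Finset.mul_sum]
    refine Finset.sum_congr rfl fun i _ => ?_
    ring
  have hG := maxSlope_nonneg (ℓ := ℓ) S w
  have hs := (summable_abs_weighting v).mul_right (maxSlope ℓ S w)
  have : ‖slope ℓ S w v‖ ≤ ∑' h : ↥H, |v h| * maxSlope ℓ S w := by
    rw [← e.tsum_eq]
    refine tsum_of_norm_bounded hs.hasSum fun h => ?_
    rw [Real.norm_eq_abs, abs_mul]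
    exact mul_le_mul_of_nonneg_left (le_ciSup (bddAbove_abs_slope hbin hℓ S w) h) (abs_nonneg _)
  rw [tsum_mul_right, ← norm_weighting_eq_tsum, Real.norm_eq_abs] at this
  calc -slope ℓ S w v ≤ |slope ℓ S w v| := neg_le_abs _
    _ ≤ ‖v‖ * maxSlope ℓ S w := this
    _ ≤ maxSlope ℓ S w := mul_le_of_le_one_left hG hv

lemma empSurrogateRisk_line_le (hbin : ∀ h ∈ H, ∀ x, h x = 1 ∨ h x = -1)
    (hℓ : IsBdsLoss ℓ β₁ β₂ B₂) (S : Fin m → X × Bool) (w : Weighting H) {h : ↥H}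
    {v : Weighting H} (hv : v = unitWeight h ∨ v = -unitWeight h) (α : ℝ) :
    empSurrogateRisk ℓ S (w + α • v) ≤
      empSurrogateRisk ℓ S w + α * slope ℓ S w v + B₂ / 2 * α ^ 2 := by
  have hB := hℓ.smoothness_pos
  calc empSurrogateRisk ℓ S (w + α • v)
      ≤ (1 / (m : ℝ)) * ∑ i, (ℓ (negMargin w (S i)) +
          α * (deriv ℓ (negMargin w (S i)) * negMargin v (S i)) + B₂ / 2 * α ^ 2 * 1) := by
        refine mean_mono fun i => ?_
        rw [negMargin_add hbin, negMargin_smul]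
        refine (hℓ.le_quadratic _ _).trans (le_of_eq ?_)
        rw [mul_pow, sq_negMargin_unitWeight hbin h hv]; ring
    _ = empSurrogateRisk ℓ S w + α * slope ℓ S w v +
          B₂ / 2 * α ^ 2 * ((1 / (m : ℝ)) * ∑ _i : Fin m, 1) := by
        simp only [Finset.sum_add_distrib, ← Finset.mul_sum, empSurrogateRisk, slope]; ring
    _ ≤ _ := by
        refine add_le_add le_rfl (mul_le_of_le_one_right (by positivity) (mean_const_le_one m))

lemma slope_line_le (hbin : ∀ h ∈ H, ∀ x, h x = 1 ∨ h x = -1)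
    (hℓ : IsBdsLoss ℓ β₁ β₂ B₂) (S : Fin m → X × Bool) (w : Weighting H) {h : ↥H}
    {v : Weighting H} (hv : v = unitWeight h ∨ v = -unitWeight h) {α : ℝ} (hα : 0 ≤ α) :
    slope ℓ S (w + α • v) v ≤ slope ℓ S w v + B₂ * α := by
  have hB := hℓ.smoothness_pos
  calc slope ℓ S (w + α • v) v
      ≤ (1 / (m : ℝ)) * ∑ i, (deriv ℓ (negMargin w (S i)) * negMargin v (S i) +
          B₂ * α * 1) := by
        refine mean_mono fun i => ?_
        rw [negMargin_add hbin, negMargin_smul]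
        have h1 := sq_negMargin_unitWeight hbin h hv (S i)
        rcases eq_or_eq_neg_of_sq_eq_sq (negMargin v (S i)) 1 (by rw [h1, one_pow]) with e | e
        · rw [e]
          have := hℓ.deriv_sub_le (x := negMargin w (S i)) (y := negMargin w (S i) + α * 1)
            (by linarith)
          linarith
        · rw [e]
          have := hℓ.deriv_sub_le (x := negMargin w (S i) + α * -1) (y := negMargin w (S i))
            (by linarith)
          linarith
    _ = slope ℓ S w v + B₂ * α * ((1 / (m : ℝ)) * ∑ _i : Fin m, 1) := by
        simp only [Finset.sum_add_distrib, ← Finset.mul_sum, slope]; ring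
    _ ≤ _ := by
        refine add_le_add le_rfl (mul_le_of_le_one_right (by positivity) (mean_const_le_one m))

lemma convexOn_empSurrogateRisk_line (hbin : ∀ h ∈ H, ∀ x, h x = 1 ∨ h x = -1)
    (hℓ : IsBdsLoss ℓ β₁ β₂ B₂) (S : Fin m → X × Bool) (w v : Weighting H) :
    ConvexOn ℝ Set.univ fun α : ℝ => empSurrogateRisk ℓ S (w + α • v) := by
  refine ⟨convex_univ, fun x _ y _ a b ha hb hab => ?_⟩
  have : ∀ i, ℓ (negMargin (w + (a • x + b • y) • v) (S i)) ≤
      a * ℓ (negMargin (w + x • v) (S i)) + b * ℓ (negMargin (w + y • v) (S i)) := by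
    intro i
    have := hℓ.convex.2 (Set.mem_univ (negMargin (w + x • v) (S i)))
      (Set.mem_univ (negMargin (w + y • v) (S i))) ha hb hab
    simp only [smul_eq_mul] at this
    refine le_trans (le_of_eq (congrArg ℓ ?_)) this
    simp only [negMargin_add hbin, negMargin_smul, smul_eq_mul]
    have hb' : b = 1 - a := by linarith
    subst hb'; ring
  refine (mean_mono this).trans (le_of_eq ?_)
  simp only [Finset.sum_add_distrib, ← Finset.mul_sum, empSurrogateRisk, smul_eq_mul]
  ring

/-- A short step does at least as well as the minimizer of the quadratic upper bound, because
by convexity the risk decreases along the line up to its minimum. -/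
lemma IsShortStep.le (hbin : ∀ h ∈ H, ∀ x, h x = 1 ∨ h x = -1)
    (hℓ : IsBdsLoss ℓ β₁ β₂ B₂) {S : Fin m → X × Bool} {w v : Weighting H} {α : ℝ}
    (hs : slope ℓ S w v ≤ 0) (h : IsShortStep ℓ B₂ S w v α) :
    empSurrogateRisk ℓ S (w + α • v) ≤
      empSurrogateRisk ℓ S (w + (-slope ℓ S w v / B₂) • v) := by
  have hB := hℓ.smoothness_pos
  obtain ⟨h0, h1⟩ := h
  have hconv := convexOn_empSurrogateRisk_line hbin hℓ S w v
  have hα₀ : 0 ≤ -slope ℓ S w v / B₂ := div_nonneg (by linarith) hB.le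
  set α₀ := -slope ℓ S w v / B₂
  rcases h1 with ⟨α', hopt, hlt⟩ | hno
  · refine (hconv.le_max_of_mem_Icc (Set.mem_univ α₀) (Set.mem_univ α') ⟨h0, hlt.le⟩).trans ?_
    exact max_le le_rfl (hopt.2 α₀ hα₀)
  · by_contra hc
    push Not at hc
    have hcont : Continuous fun α : ℝ => empSurrogateRisk ℓ S (w + α • v) := by
      have := hℓ.continuous
      simp only [empSurrogateRisk, negMargin_add hbin, negMargin_smul]
      fun_prop
    obtain ⟨b, hb, hmin⟩ := (isCompact_Icc (a := (0 : ℝ)) (b := α)).exists_isMinOn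
      ⟨0, le_rfl, hα₀.trans h0⟩ hcont.continuousOn
    refine hno ⟨b, hb.1, fun α' hα' => ?_⟩
    rcases le_total α' α with hle | hle
    · exact hmin ⟨hα', hle⟩
    · have h2 := hconv.le_max_of_mem_Icc (Set.mem_univ α₀) (Set.mem_univ α') ⟨h0, hle⟩
      have h3 : empSurrogateRisk ℓ S (w + b • v) ≤ empSurrogateRisk ℓ S (w + α • v) :=
        hmin ⟨hα₀.trans h0, le_rfl⟩
      rcases le_max_iff.1 h2 with h4 | h4
      · exact absurd hc (not_lt.2 h4)
      · exact h3.trans h4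

/-- Every admissible step decreases the empirical surrogate risk quadratically in the largest
slope; the constant `1 / 6` is the one of the Wolfe steps. -/
lemma IsBoostStep.descent (hbin : ∀ h ∈ H, ∀ x, h x = 1 ∨ h x = -1)
    (hℓ : IsBdsLoss ℓ β₁ β₂ B₂) {ρ : ℝ} (hρ : 0 ≤ ρ) {S : Fin m → X × Bool}
    {w w' : Weighting H} (h : IsBoostStep ℓ B₂ ρ S w w') :
    empSurrogateRisk ℓ S w' ≤ empSurrogateRisk ℓ S w - (ρ * maxSlope ℓ S w) ^ 2 / (6 * B₂) := by
  have hB := hℓ.smoothness_pos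
  obtain ⟨h, v, α, -, hv, hs, -, hα, rfl⟩ := h
  have hG := mul_nonneg hρ (maxSlope_nonneg (ℓ := ℓ) S w)
  have hs0 : slope ℓ S w v ≤ 0 := by linarith
  have hsq : (ρ * maxSlope ℓ S w) ^ 2 ≤ slope ℓ S w v ^ 2 := by nlinarith
  suffices h' : empSurrogateRisk ℓ S (w + α • v) ≤
      empSurrogateRisk ℓ S w - slope ℓ S w v ^ 2 / (6 * B₂) by
    have := div_le_div_of_nonneg_right hsq (by positivity : 0 ≤ 6 * B₂)
    linarith
  set s := slope ℓ S w v
  have hα₀ : 0 ≤ -s / B₂ := div_nonneg (by linarith) hB.le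
  have hquad : empSurrogateRisk ℓ S (w + (-s / B₂) • v) ≤
      empSurrogateRisk ℓ S w - s ^ 2 / (6 * B₂) := by
    refine (empSurrogateRisk_line_le hbin hℓ S w hv (-s / B₂)).trans ?_
    have e : -s / B₂ * s + B₂ / 2 * (-s / B₂) ^ 2 = -(s ^ 2 / (6 * B₂)) - s ^ 2 / (3 * B₂) := by
      field_simp; ring
    have : 0 ≤ s ^ 2 / (3 * B₂) := by positivity
    linarith
  rcases hα with hα | hα | hα
  · exact (hα.2 _ hα₀).trans hquad
  · exact (hα.le hbin hℓ hs0).trans hquad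
  · obtain ⟨h0, h1, h2⟩ := hα
    have h3 := slope_line_le hbin hℓ S w hv h0
    -- the curvature condition forces a step of length at least `-s / (2 * B₂)`
    have h4 : -s / (2 * B₂) ≤ α := by
      rw [div_le_iff₀ (by positivity)]; linarith
    have h5 : α * (1 / 3) * s ≤ -s / (2 * B₂) * (1 / 3) * s := by nlinarith
    have e : -s / (2 * B₂) * (1 / 3) * s = -(s ^ 2 / (6 * B₂)) := by field_simp; ring
    linarith

/-- While the largest slope stays above `κ`, the empirical surrogate risk drops by a fixed amount
in every iteration.  The slope need only be bounded below where the risk has not increased. -/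
lemma empSurrogateRisk_iterate_le (hbin : ∀ h ∈ H, ∀ x, h x = 1 ∨ h x = -1)
    (hℓ : IsBdsLoss ℓ β₁ β₂ B₂) {ρ κ : ℝ} (hρ : 0 ≤ ρ) (hκ : 0 ≤ κ) {S : Fin m → X × Bool}
    {it : ℕ → Weighting H} {T : ℕ}
    (hstep : ∀ t < T, IsBoostStep ℓ B₂ ρ S (it t) (it (t + 1)))
    (hslope : ∀ t < T, empSurrogateRisk ℓ S (it t) ≤ empSurrogateRisk ℓ S (it 0) →
      κ ≤ maxSlope ℓ S (it t)) :
    empSurrogateRisk ℓ S (it T) ≤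
      empSurrogateRisk ℓ S (it 0) - T * ((ρ * κ) ^ 2 / (6 * B₂)) := by
  have hB := hℓ.smoothness_pos
  induction T with
  | zero => simp
  | succ T ih =>
    have h1 := ih (fun t ht => hstep t (by omega)) (fun t ht => hslope t (by omega))
    have h0 : 0 ≤ (T : ℝ) * ((ρ * κ) ^ 2 / (6 * B₂)) := by positivity
    have h2 := hslope T (by omega) (by linarith)
    have h3 := (hstep T (by omega)).descent hbin hℓ hρ
    have h4 : (ρ * κ) ^ 2 / (6 * B₂) ≤ (ρ * maxSlope ℓ S (it T)) ^ 2 / (6 * B₂) := by gcongr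
    push_cast
    linarith

end Descent

/-! ### A smoothed positive part -/

/-- The ramp from `0` at `0` to `1` at `η`. -/
noncomputable def ramp (η x : ℝ) : ℝ := max 0 (min 1 (x / η))

/-- The positive part smoothed at scale `η`: the maximum over `r` in `[0, 1]` of
`r * x - η * r ^ 2 / 2`, which is attained at `r = ramp η x`. -/
noncomputable def smoothPos (η x : ℝ) : ℝ := ramp η x * x - η / 2 * ramp η x ^ 2

lemma ramp_nonneg (η x : ℝ) : 0 ≤ ramp η x := le_max_left _ _

lemma ramp_le_one (η x : ℝ) : ramp η x ≤ 1 := max_le zero_le_one (min_le_left _ _)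

lemma ramp_of_nonpos {η x : ℝ} (hη : 0 < η) (hx : x ≤ 0) : ramp η x = 0 :=
  max_eq_left ((min_le_right _ _).trans (div_nonpos_of_nonpos_of_nonneg hx hη.le))

lemma ramp_of_le {η x : ℝ} (hη : 0 < η) (hx : η ≤ x) : ramp η x = 1 := by
  rw [ramp, min_eq_left ((one_le_div hη).2 hx), max_eq_right zero_le_one]

lemma ramp_of_mem {η x : ℝ} (hη : 0 < η) (h0 : 0 ≤ x) (h1 : x ≤ η) : ramp η x = x / η := by
  rw [ramp, min_eq_right ((div_le_one hη).2 h1), max_eq_right (div_nonneg h0 hη.le)]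

lemma continuous_ramp (η : ℝ) : Continuous (ramp η) := by unfold ramp; fun_prop

lemma continuous_smoothPos (η : ℝ) : Continuous (smoothPos η) := by
  have := continuous_ramp η
  unfold smoothPos; fun_prop

lemma ramp_optimal {η : ℝ} (hη : 0 < η) (x : ℝ) {r : ℝ} (h0 : 0 ≤ r) (h1 : r ≤ 1) :
    (r - ramp η x) * (x - η * ramp η x) ≤ 0 := by
  rcases le_total x 0 with h | h
  · rw [ramp_of_nonpos hη h]; nlinarith
  rcases le_total η x with h' | h'
  · rw [ramp_of_le hη h']; nlinarith
  · rw [ramp_of_mem hη h h', mul_div_cancel₀ _ hη.ne']; simp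

lemma tangent_le_smoothPos {η : ℝ} (hη : 0 < η) (x y : ℝ) :
    smoothPos η x + ramp η x * (y - x) ≤ smoothPos η y := by
  have := ramp_optimal hη y (ramp_nonneg η x) (ramp_le_one η x)
  unfold smoothPos
  nlinarith [mul_nonneg hη.le (sq_nonneg (ramp η x - ramp η y))]

lemma smoothPos_le_quadratic {η : ℝ} (hη : 0 < η) (x y : ℝ) :
    smoothPos η y ≤ smoothPos η x + ramp η x * (y - x) + (y - x) ^ 2 / (2 * η) := by
  have h1 := ramp_optimal hη x (ramp_nonneg η y) (ramp_le_one η y)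
  have h2 : (ramp η y - ramp η x) * (y - x) - η / 2 * (ramp η y - ramp η x) ^ 2 ≤
      (y - x) ^ 2 / (2 * η) := by
    rw [le_div_iff₀ (by positivity)]
    nlinarith [sq_nonneg (η * (ramp η y - ramp η x) - (y - x))]
  unfold smoothPos
  nlinarith

lemma max_zero_le_ramp_mul_add {η : ℝ} (hη : 0 < η) (x : ℝ) :
    max x 0 ≤ ramp η x * x + η := by
  rcases le_total x 0 with h | h
  · rw [ramp_of_nonpos hη h, max_eq_right h]; linarith
  rw [max_eq_left h]
  rcases le_total η x with h' | h'
  · rw [ramp_of_le hη h']; linarith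
  · rw [ramp_of_mem hη h h']
    have : 0 ≤ x / η * x := by positivity
    linarith

lemma abs_smoothPos_le {η : ℝ} (hη : 0 < η) (x : ℝ) : |smoothPos η x| ≤ |x| + η := by
  have h0 := ramp_nonneg η x
  have h1 := ramp_le_one η x
  have h2 : |ramp η x * x| ≤ |x| := by
    rw [abs_mul, abs_of_nonneg h0]; exact mul_le_of_le_one_left (abs_nonneg _) h1
  have h3 : ramp η x ^ 2 ≤ 1 := pow_le_one₀ h0 h1
  have h4 := abs_le.1 h2
  unfold smoothPos
  rw [abs_le]
  constructor <;> nlinarith [sq_nonneg (ramp η x)]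

/-! ### A comparator with few small margins -/

section Comparator

variable {Z : Type*} [MeasurableSpace Z] {ν : Measure Z} [IsProbabilityMeasure ν]

lemma integrable_of_abs_le {f : Z → ℝ} (hf : Measurable f) {c : ℝ} (h : ∀ z, |f z| ≤ c) :
    Integrable f ν :=
  Integrable.of_bound hf.aestronglyMeasurable c (ae_of_all _ h)

/-- A level `b` at which the ramp has a prescribed mean. -/
lemma exists_integral_ramp_eq {f : Z → ℝ} (hf : Measurable f) (hf1 : ∀ z, |f z| ≤ 1)
    {η κ : ℝ} (hη : 0 < η) (hκ0 : 0 ≤ κ) (hκ1 : κ ≤ 1) :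
    ∃ b ∈ Set.Icc (-1) (1 + η), ∫ z, ramp η (b - f z) ∂ν = κ := by
  have hc : Continuous fun b : ℝ => ∫ z, ramp η (b - f z) ∂ν := by
    refine continuous_of_dominated (bound := fun _ => 1) (fun b => ?_) (fun b => ?_)
      (integrable_const _) (ae_of_all _ fun z => ?_)
    · exact ((continuous_ramp η).measurable.comp (measurable_const.sub hf)).aestronglyMeasurable
    · refine ae_of_all _ fun z => ?_
      rw [Real.norm_eq_abs, abs_of_nonneg (ramp_nonneg _ _)]
      exact ramp_le_one _ _
    · exact (continuous_ramp η).comp (continuous_id.sub continuous_const)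
  have h1 : ∫ z, ramp η (-1 - f z) ∂ν = 0 := by
    rw [← integral_zero Z ℝ (μ := ν)]
    congr 1; funext z
    exact ramp_of_nonpos hη (by linarith [(abs_le.1 (hf1 z)).1])
  have h2 : ∫ z, ramp η (1 + η - f z) ∂ν = 1 := by
    have : (fun z => ramp η (1 + η - f z)) = fun _ => 1 := by
      funext z
      exact ramp_of_le hη (by linarith [(abs_le.1 (hf1 z)).2])
    rw [this]; simp
  obtain ⟨b, hb, e⟩ := intermediate_value_Icc (by linarith : (-1 : ℝ) ≤ 1 + η) hc.continuousOn
    (show κ ∈ Set.Icc _ _ by rw [h1, h2]; exact ⟨hκ0, hκ1⟩)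
  exact ⟨b, hb, e⟩

/-- A minimax principle.  If every density bounded by `1 / κ` is beaten by some member of the
convex class `C`, then a single member has a large lower `κ`-tail average, written in the
variational form `b - (1 / κ) * ∫ (b - f)₊`.  A near-maximizer of the variational form with a
smoothed positive part induces a density, and first-order optimality against the member that
beats this density gives the bound. -/
lemma exists_comparator {C : Set (Z → ℝ)} {κ g g₁ : ℝ} (hκ0 : 0 < κ) (hκ1 : κ ≤ 1)
    (hmeas : ∀ f ∈ C, Measurable f) (hbdd : ∀ f ∈ C, ∀ z, |f z| ≤ 1)
    (hconv : ∀ f ∈ C, ∀ f' ∈ C, ∀ τ ∈ Set.Icc (0 : ℝ) 1, (fun z => f z + τ * (f' z - f z)) ∈ C)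
    (hdens : ∀ p : Z → ℝ, Measurable p → (∀ z, 0 ≤ p z) → (∀ z, p z ≤ 1 / κ) →
      ∫ z, p z ∂ν = 1 → ∃ f ∈ C, g₁ ≤ ∫ z, f z * p z ∂ν)
    (hg : g < g₁) :
    ∃ f ∈ C, ∃ b ≤ 1, g ≤ b - (1 / κ) * ∫ z, max (b - f z) 0 ∂ν := by
  set η : ℝ := κ * (g₁ - g) / 2 with hηdef
  have hη : 0 < η := by have := sub_pos.2 hg; positivity
  have hIs : ∀ f ∈ C, ∀ b, Integrable (fun z => smoothPos η (b - f z)) ν := by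
    intro f hf b
    refine integrable_of_abs_le (c := |b| + 1 + η)
      ((continuous_smoothPos η).measurable.comp (measurable_const.sub (hmeas f hf))) fun z => ?_
    have h1 := abs_smoothPos_le hη (b - f z)
    have h2 := abs_sub b (f z)
    have h3 := hbdd f hf z
    linarith
  have hIr : ∀ f ∈ C, ∀ b, ∀ k : Z → ℝ, Measurable k → ∀ c, (∀ z, |k z| ≤ c) →
      Integrable (fun z => ramp η (b - f z) * k z) ν := by
    intro f hf b k hk c hc
    refine integrable_of_abs_le (c := c)
      (((continuous_ramp η).measurable.comp (measurable_const.sub (hmeas f hf))).mul hk)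
      fun z => ?_
    rw [abs_mul, abs_of_nonneg (ramp_nonneg _ _)]
    exact (mul_le_of_le_one_left (abs_nonneg _) (ramp_le_one _ _)).trans (hc z)
  set G : (Z → ℝ) → ℝ → ℝ := fun f b => b - (1 / κ) * ∫ z, smoothPos η (b - f z) ∂ν with hG
  -- the tangent inequality in the level, at a level where the ramp has mean `κ`
  have hlevel : ∀ f ∈ C, ∀ b b', ∫ z, ramp η (b - f z) ∂ν = κ → G f b' ≤ G f b := by
    intro f hf b b' hb
    have h1 : ∫ z, (smoothPos η (b - f z) + ramp η (b - f z) * (b' - b)) ∂ν ≤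
        ∫ z, smoothPos η (b' - f z) ∂ν := by
      refine integral_mono ((hIs f hf b).add
        (hIr f hf b (fun _ => b' - b) measurable_const _ fun _ => le_rfl)) (hIs f hf b')
        fun z => ?_
      have := tangent_le_smoothPos hη (b - f z) (b' - f z)
      simpa using this
    rw [integral_add (hIs f hf b)
        (hIr f hf b (fun _ => b' - b) measurable_const _ fun _ => le_rfl),
      integral_mul_const, hb] at h1
    have h2 := mul_le_mul_of_nonneg_left h1 (by positivity : 0 ≤ 1 / κ)
    have e : 1 / κ * (κ * (b' - b)) = b' - b := by field_simp
    rw [mul_add, e] at h2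
    simp only [hG]; linarith
  -- the smoothed objective is bounded above
  have hGle : ∀ f ∈ C, ∀ b, G f b ≤ 1 + η := by
    intro f hf b
    obtain ⟨b₁, hb₁, e⟩ := exists_integral_ramp_eq (ν := ν) (hmeas f hf) (hbdd f hf) hη hκ0.le hκ1
    refine (hlevel f hf b₁ b e).trans ?_
    have : 0 ≤ ∫ z, smoothPos η (b₁ - f z) ∂ν := by
      refine integral_nonneg fun z => ?_
      have := tangent_le_smoothPos hη 0 (b₁ - f z)
      simpa [smoothPos, ramp_of_nonpos hη le_rfl] using this
    have : 0 ≤ 1 / κ * ∫ z, smoothPos η (b₁ - f z) ∂ν := by positivity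
    simp only [hG]; linarith [hb₁.2]
  obtain ⟨f₀, hf₀, -⟩ := hdens (fun _ => 1) measurable_const (fun _ => zero_le_one)
    (fun _ => (one_le_div hκ0).2 hκ1) (by simp)
  set A : Set ℝ := {a | ∃ f ∈ C, ∃ b, a = G f b} with hA
  have hAne : A.Nonempty := ⟨_, f₀, hf₀, 0, rfl⟩
  have hAbdd : BddAbove A := ⟨1 + η, by rintro _ ⟨f, hf, b, rfl⟩; exact hGle f hf b⟩
  -- the size `τ` of the step towards the competitor; the near-maximizer is within `τ ^ 2`
  set c : ℝ := 1 + 2 / (η * κ) with hc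
  have hcpos : 0 < c := by positivity
  set τ : ℝ := min 1 ((g₁ - g) / (2 * c)) with hτ
  have hτ0 : 0 < τ := lt_min one_pos (by have := sub_pos.2 hg; positivity)
  have hτ1 : τ ≤ 1 := min_le_left _ _
  have hτc : τ * c ≤ (g₁ - g) / 2 := by
    have : τ ≤ (g₁ - g) / (2 * c) := min_le_right _ _
    calc τ * c ≤ (g₁ - g) / (2 * c) * c := by gcongr
      _ = (g₁ - g) / 2 := by field_simp
  obtain ⟨_, ⟨f, hf, b', rfl⟩, hnear⟩ :=
    exists_lt_of_lt_csSup hAne (show sSup A - τ ^ 2 < sSup A by have := pow_pos hτ0 2; linarith)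
  obtain ⟨b, -, hb⟩ := exists_integral_ramp_eq (ν := ν) (hmeas f hf) (hbdd f hf) hη hκ0.le hκ1
  have hmax : ∀ f' ∈ C, G f' b ≤ G f b + τ ^ 2 := by
    intro f' hf'
    have h1 : G f' b ≤ sSup A := le_csSup hAbdd ⟨f', hf', b, rfl⟩
    have h2 := hlevel f hf b b' hb
    linarith
  obtain ⟨f', hf', hbeat⟩ := hdens (fun z => ramp η (b - f z) * (1 / κ))
    (((continuous_ramp η).measurable.comp (measurable_const.sub (hmeas f hf))).mul_const _)
    (fun z => mul_nonneg (ramp_nonneg _ _) (by positivity))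
    (fun z => mul_le_of_le_one_left (by positivity) (ramp_le_one _ _))
    (by rw [integral_mul_const, hb]; field_simp)
  have hIf : Integrable (fun z => ramp η (b - f z) * f z) ν :=
    hIr f hf b f (hmeas f hf) 1 (hbdd f hf)
  have hIf' : Integrable (fun z => ramp η (b - f z) * f' z) ν :=
    hIr f hf b f' (hmeas f' hf') 1 (hbdd f' hf')
  have hIone : Integrable (fun z => ramp η (b - f z)) ν := by
    have := hIr f hf b (fun _ => 1) measurable_const 1 (by simp)
    simpa using this
  have hbeat' : g₁ ≤ (1 / κ) * ∫ z, ramp η (b - f z) * f' z ∂ν := by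
    refine hbeat.trans (le_of_eq ?_)
    rw [← integral_const_mul]; congr 1; funext z; ring
  -- first-order optimality
  have hopt : (1 / κ) * (∫ z, ramp η (b - f z) * f' z ∂ν) - τ * c ≤
      (1 / κ) * ∫ z, ramp η (b - f z) * f z ∂ν := by
    have h1 := hmax _ (hconv f hf f' hf' τ ⟨hτ0.le, hτ1⟩)
    have h2 : ∫ z, smoothPos η (b - (f z + τ * (f' z - f z))) ∂ν ≤
        ∫ z, (smoothPos η (b - f z) + τ * (ramp η (b - f z) * f z) -
          τ * (ramp η (b - f z) * f' z) + 2 * τ ^ 2 / η) ∂ν := by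
      refine integral_mono (hIs _ (hconv f hf f' hf' τ ⟨hτ0.le, hτ1⟩) b)
        ((((hIs f hf b).add (hIf.const_mul τ)).sub (hIf'.const_mul τ)).add
          (integrable_const _)) fun z => ?_
      refine (smoothPos_le_quadratic hη (b - f z) _).trans ?_
      have h3 := abs_le.1 (hbdd f hf z)
      have h4 := abs_le.1 (hbdd f' hf' z)
      have h5 : (f' z - f z) ^ 2 ≤ 4 := by nlinarith
      have h6 : (b - (f z + τ * (f' z - f z)) - (b - f z)) ^ 2 / (2 * η) ≤ 2 * τ ^ 2 / η := by
        rw [div_le_div_iff₀ (by positivity) hη]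
        nlinarith [mul_le_mul_of_nonneg_left h5 (by positivity : 0 ≤ τ ^ 2 * η)]
      linarith
    have hJ : Integrable (fun z => smoothPos η (b - f z) + τ * (ramp η (b - f z) * f z)) ν :=
      (hIs f hf b).add (hIf.const_mul τ)
    have hJ' : Integrable (fun z => smoothPos η (b - f z) + τ * (ramp η (b - f z) * f z) -
        τ * (ramp η (b - f z) * f' z)) ν := hJ.sub (hIf'.const_mul τ)
    rw [integral_add hJ' (integrable_const _), integral_sub hJ (hIf'.const_mul τ),
      integral_add (hIs f hf b) (hIf.const_mul τ), integral_const_mul, integral_const_mul] at h2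
    simp only [integral_const, probReal_univ, one_smul] at h2
    simp only [hG] at h1
    have h7 := mul_le_mul_of_nonneg_left h2 (by positivity : 0 ≤ 1 / κ)
    have h8 : τ * ((1 / κ) * (∫ z, ramp η (b - f z) * f' z ∂ν) -
        (1 / κ) * ∫ z, ramp η (b - f z) * f z ∂ν) ≤ τ * (τ * c) := by
      have e : τ * (τ * c) = τ ^ 2 + 1 / κ * (2 * τ ^ 2 / η) := by
        rw [hc]; field_simp
      rw [e]; linarith
    have := le_of_mul_le_mul_left h8 hτ0
    linarith
  -- the smoothed level beats `g`
  have hfin : g ≤ b - (1 / κ) * ∫ z, max (b - f z) 0 ∂ν := by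
    have hImax : Integrable (fun z => max (b - f z) 0) ν := by
      refine integrable_of_abs_le (c := |b| + 1)
        ((measurable_const.sub (hmeas f hf)).max measurable_const) fun z => ?_
      have h2 := abs_sub b (f z)
      have h3 := hbdd f hf z
      rw [abs_of_nonneg (le_max_right _ _)]
      exact max_le ((le_abs_self _).trans (by linarith)) (by positivity)
    have h1 : ∫ z, max (b - f z) 0 ∂ν ≤
        ∫ z, (ramp η (b - f z) * b - ramp η (b - f z) * f z + η) ∂ν := by
      refine integral_mono hImax (((hIone.mul_const b).sub hIf).add (integrable_const _))
        fun z => ?_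
      refine (max_zero_le_ramp_mul_add hη (b - f z)).trans (le_of_eq ?_)
      ring
    have hJ : Integrable (fun z => ramp η (b - f z) * b - ramp η (b - f z) * f z) ν :=
      (hIone.mul_const b).sub hIf
    rw [integral_add hJ (integrable_const _),
      integral_sub (hIone.mul_const b) hIf, integral_mul_const, hb] at h1
    simp only [integral_const, probReal_univ, one_smul] at h1
    have h2 := mul_le_mul_of_nonneg_left h1 (by positivity : 0 ≤ 1 / κ)
    have e : 1 / κ * (κ * b - ∫ z, ramp η (b - f z) * f z ∂ν + η) =
        b - 1 / κ * (∫ z, ramp η (b - f z) * f z ∂ν) + (g₁ - g) / 2 := by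
      rw [hηdef]; field_simp
    rw [e] at h2
    linarith
  rcases le_or_gt b 1 with hb1 | hb1
  · exact ⟨f, hf, b, hb1, hfin⟩
  · -- margins are at most `1`, so a level above `1` can be lowered to `1`
    refine ⟨f, hf, 1, le_rfl, hfin.trans ?_⟩
    have hfi : Integrable f ν := integrable_of_abs_le (hmeas f hf) (hbdd f hf)
    have e : ∀ b : ℝ, 1 ≤ b → ∫ z, max (b - f z) 0 ∂ν = b - ∫ z, f z ∂ν := by
      intro b hb
      have : (fun z => max (b - f z) 0) = fun z => b - f z := by
        funext z
        exact max_eq_left (by linarith [(abs_le.1 (hbdd f hf z)).2])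
      rw [this, integral_sub (integrable_const _) hfi]
      simp
    rw [e b hb1.le, e 1 le_rfl]
    have h1 : b - 1 ≤ 1 / κ * (b - 1) :=
      le_mul_of_one_le_left (by linarith) ((one_le_div hκ0).2 hκ1)
    nlinarith

end Comparator

/-! ### The margin functional of the source distribution -/

section Gam

variable {X : Type*} [MeasurableSpace X] {H : Set (X → ℝ)} {μ : Measure (X × Bool)}

lemma mem_densities [IsProbabilityMeasure μ] {κ : ℝ} (hκ : 0 < κ) {p : X × Bool → ℝ}
    (hp : Measurable p) (h0 : ∀ z, 0 ≤ p z) (h1 : ∀ z, p z ≤ 1 / κ) (hint : ∫ z, p z ∂μ = 1) :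
    p ∈ densities κ μ := by
  have habs : ∀ z, ‖p z‖ ≤ 1 / κ := fun z => by
    rw [Real.norm_eq_abs, abs_of_nonneg (h0 z)]; exact h1 z
  have hi : Integrable p μ := Integrable.of_bound hp.aestronglyMeasurable _ (ae_of_all _ habs)
  refine ⟨memLp_one_iff_integrable.2 hi, ae_of_all _ h0, ?_, ?_⟩
  · rw [eLpNorm_one_eq_lintegral_enorm, ← ofReal_integral_norm_eq_lintegral_enorm hi]
    have : (fun z => ‖p z‖) = p := by
      funext z; rw [Real.norm_eq_abs, abs_of_nonneg (h0 z)]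
    rw [this, hint, ENNReal.ofReal_one]
  · rw [eLpNorm_exponent_top, ← ENNReal.ofReal_inv_of_pos hκ, ← one_div]
    exact eLpNormEssSup_le_of_ae_bound (ae_of_all _ habs)

lemma densities_spec {κ : ℝ} (hκ : 0 < κ) {p : X × Bool → ℝ} (hp : p ∈ densities κ μ) :
    Integrable p μ ∧ (∀ᵐ z ∂μ, 0 ≤ p z) ∧ (∀ᵐ z ∂μ, p z ≤ 1 / κ) ∧ ∫ z, p z ∂μ = 1 := by
  obtain ⟨h1, h2, h3, h4⟩ := hp
  have hi : Integrable p μ := memLp_one_iff_integrable.1 h1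
  refine ⟨hi, h2, ?_, ?_⟩
  · rw [eLpNorm_exponent_top, ← ENNReal.ofReal_inv_of_pos hκ, ← one_div] at h4
    filter_upwards [ae_le_eLpNormEssSup (f := p) (μ := μ)] with z hz
    have h5 := hz.trans h4
    rw [← ofReal_norm, ENNReal.ofReal_le_ofReal_iff (by positivity)] at h5
    exact (le_abs_self _).trans h5
  · rw [eLpNorm_one_eq_lintegral_enorm, ← ofReal_integral_norm_eq_lintegral_enorm hi,
      ENNReal.ofReal_eq_one] at h3
    rw [← h3]
    refine integral_congr_ae ?_
    filter_upwards [h2] with z hz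
    rw [Real.norm_eq_abs, abs_of_nonneg hz]

lemma integrable_negMargin_mul (hbin : ∀ h ∈ H, ∀ x, h x = 1 ∨ h x = -1)
    (hmeas : ∀ h ∈ H, Measurable h) (w : Weighting H) {p : X × Bool → ℝ}
    (hp : Integrable p μ) : Integrable (fun z => negMargin w z * p z) μ :=
  hp.bdd_mul (c := ‖w‖) (measurable_negMargin hmeas w).aestronglyMeasurable
    (ae_of_all _ fun z => abs_negMargin_le hbin w z)

lemma neg_integral_negMargin_le (hbin : ∀ h ∈ H, ∀ x, h x = 1 ∨ h x = -1)
    (hmeas : ∀ h ∈ H, Measurable h) {κ : ℝ} (hκ : 0 < κ) {p : X × Bool → ℝ}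
    (hp : p ∈ densities κ μ) (w : Weighting H) (hw : ‖w‖ ≤ 1) :
    -∫ z, negMargin w z * p z ∂μ ≤ 1 := by
  obtain ⟨hi, h0, -, h1⟩ := densities_spec hκ hp
  rw [← integral_neg, ← h1]
  refine integral_mono_ae (integrable_negMargin_mul hbin hmeas w hi).neg hi ?_
  filter_upwards [h0] with z hz
  have h2 := abs_le.1 ((abs_negMargin_le hbin w z).trans hw)
  show -(negMargin w z * p z) ≤ p z
  nlinarith

lemma bddAbove_neg_integral_negMargin (hbin : ∀ h ∈ H, ∀ x, h x = 1 ∨ h x = -1)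
    (hmeas : ∀ h ∈ H, Measurable h) {κ : ℝ} (hκ : 0 < κ) {p : X × Bool → ℝ}
    (hp : p ∈ densities κ μ) :
    BddAbove (Set.range fun w : {w : Weighting H // ‖w‖ ≤ 1} =>
      -∫ z, negMargin w.1 z * p z ∂μ) :=
  ⟨1, by rintro _ ⟨w, rfl⟩; exact neg_integral_negMargin_le hbin hmeas hκ hp w.1 w.2⟩

lemma gam_le (κ : ℝ) {p : X × Bool → ℝ} (hp : p ∈ densities κ μ) :
    gam H κ μ ≤ ⨆ w : {w : Weighting H // ‖w‖ ≤ 1}, -∫ z, negMargin w.1 z * p z ∂μ := by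
  refine ciInf_le (f := fun p : ↥(densities κ μ) =>
    ⨆ w : {w : Weighting H // ‖w‖ ≤ 1}, -∫ z, negMargin w.1 z * p.1 z ∂μ) ⟨0, ?_⟩ ⟨p, hp⟩
  rintro _ ⟨q, rfl⟩
  exact Real.iSup_nonneg' ⟨⟨0, by simp⟩, by simp [negMargin_zero]⟩

lemma one_mem_densities [IsProbabilityMeasure μ] {κ : ℝ} (hκ0 : 0 < κ) (hκ1 : κ ≤ 1) :
    (fun _ => 1) ∈ densities κ μ :=
  mem_densities hκ0 measurable_const (fun _ => zero_le_one) (fun _ => (one_le_div hκ0).2 hκ1)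
    (by simp)

lemma gam_le_one [IsProbabilityMeasure μ]
    (hbin : ∀ h ∈ H, ∀ x, h x = 1 ∨ h x = -1)
    (hmeas : ∀ h ∈ H, Measurable h) {κ : ℝ} (hκ0 : 0 < κ) (hκ1 : κ ≤ 1) :
    gam H κ μ ≤ 1 := by
  have hp := one_mem_densities (μ := μ) hκ0 hκ1
  refine (gam_le κ hp).trans ?_
  have : Nonempty {w : Weighting H // ‖w‖ ≤ 1} := ⟨⟨0, by simp⟩⟩
  exact ciSup_le fun w => neg_integral_negMargin_le hbin hmeas hκ0 hp w.1 w.2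

/-- A weighting of small surrogate risk has, by the tangent inequality at `0`, a large margin on
average under every density bounded by `1 / κ`; after normalization it shows that `γ_κ(μ)` is
positive. -/
lemma gam_pos [IsProbabilityMeasure μ]
    (hbin : ∀ h ∈ H, ∀ x, h x = 1 ∨ h x = -1)
    (hmeas : ∀ h ∈ H, Measurable h) {ℓ : ℝ → ℝ} {β₁ β₂ B₂ : ℝ} (hℓ : IsBdsLoss ℓ β₁ β₂ B₂)
    (hL : optSurrogateRisk ℓ H μ = 0) {κ : ℝ} (hκ0 : 0 < κ) (hκ1 : κ ≤ 1) :
    0 < gam H κ μ := by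
  have hl0 := hℓ.pos_zero
  have hd0 := hℓ.deriv_pos_zero
  obtain ⟨w, hw⟩ := exists_lt_of_ciInf_lt
    (show optSurrogateRisk ℓ H μ < κ * ℓ 0 / 2 by rw [hL]; positivity)
  have hm := measurable_negMargin hmeas w
  have hIl : Integrable (fun z => ℓ (negMargin w z)) μ := by
    refine Integrable.of_bound (hℓ.continuous.measurable.comp hm).aestronglyMeasurable (ℓ ‖w‖)
      (ae_of_all _ fun z => ?_)
    rw [Real.norm_eq_abs, abs_of_nonneg (hℓ.nonneg _)]
    exact hℓ.mono ((le_abs_self _).trans (abs_negMargin_le hbin w z))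
  have key : ∀ p ∈ densities κ μ,
      ℓ 0 / (2 * deriv ℓ 0) ≤ -∫ z, negMargin w z * p z ∂μ := by
    intro p hp
    obtain ⟨hi, h0, h1, h2⟩ := densities_spec hκ0 hp
    have h3 : ∫ z, (ℓ 0 * p z + deriv ℓ 0 * (negMargin w z * p z)) ∂μ ≤
        ∫ z, 1 / κ * ℓ (negMargin w z) ∂μ := by
      refine integral_mono_ae ((hi.const_mul _).add
        ((integrable_negMargin_mul hbin hmeas w hi).const_mul _)) (hIl.const_mul _) ?_
      filter_upwards [h0, h1] with z hz0 hz1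
      have h4 := hℓ.tangent_le 0 (negMargin w z)
      have h5 := hℓ.nonneg (negMargin w z)
      rw [sub_zero] at h4
      calc ℓ 0 * p z + deriv ℓ 0 * (negMargin w z * p z)
          = (ℓ 0 + deriv ℓ 0 * negMargin w z) * p z := by ring
        _ ≤ ℓ (negMargin w z) * p z := mul_le_mul_of_nonneg_right h4 hz0
        _ ≤ ℓ (negMargin w z) * (1 / κ) := mul_le_mul_of_nonneg_left hz1 h5
        _ = 1 / κ * ℓ (negMargin w z) := mul_comm _ _
    rw [integral_add (hi.const_mul _) ((integrable_negMargin_mul hbin hmeas w hi).const_mul _),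
      integral_const_mul, integral_const_mul, integral_const_mul, h2] at h3
    have h6 : 1 / κ * ∫ z, ℓ (negMargin w z) ∂μ ≤ 1 / κ * (κ * ℓ 0 / 2) := by gcongr
    have e : 1 / κ * (κ * ℓ 0 / 2) = ℓ 0 / 2 := by field_simp
    rw [e] at h6
    rw [div_le_iff₀ (by positivity)]
    linarith
  have hne : Nonempty ↥(densities κ μ) := ⟨⟨_, one_mem_densities hκ0 hκ1⟩⟩
  -- the factor `‖w‖ + 1` avoids the case distinction `w = 0`
  have hn : 0 < ‖w‖ + 1 := by positivity
  have hc : 0 < (‖w‖ + 1)⁻¹ * (ℓ 0 / (2 * deriv ℓ 0)) := by positivity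
  refine hc.trans_le (le_ciInf fun p => ?_)
  have hw1 : ‖(‖w‖ + 1)⁻¹ • w‖ ≤ 1 := by
    rw [norm_smul, Real.norm_eq_abs, abs_of_pos (inv_pos.2 hn), inv_mul_le_iff₀ hn]
    linarith
  refine le_trans ?_ (le_ciSup (bddAbove_neg_integral_negMargin hbin hmeas hκ0 p.2)
    ⟨(‖w‖ + 1)⁻¹ • w, hw1⟩)
  have e : ∫ z, negMargin ((‖w‖ + 1)⁻¹ • w) z * p.1 z ∂μ =
      (‖w‖ + 1)⁻¹ * ∫ z, negMargin w z * p.1 z ∂μ := by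
    rw [← integral_const_mul]
    congr 1; funext z; rw [negMargin_smul]; ring
  have := mul_le_mul_of_nonneg_left (key p.1 p.2) (inv_pos.2 hn).le
  simp only [e]
  linarith

/-- A weighting in the unit ball whose margins `-A v` have lower `κ`-tail average at least `g`,
for any `g < γ_κ(μ)`. -/
lemma exists_comparator_weighting [IsProbabilityMeasure μ]
    (hbin : ∀ h ∈ H, ∀ x, h x = 1 ∨ h x = -1)
    (hmeas : ∀ h ∈ H, Measurable h) {κ g : ℝ} (hκ0 : 0 < κ) (hκ1 : κ ≤ 1)
    (hg : g < gam H κ μ) :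
    ∃ v : Weighting H, ‖v‖ ≤ 1 ∧ ∃ b ≤ 1,
      g ≤ b - (1 / κ) * ∫ z, max (b + negMargin v z) 0 ∂μ := by
  obtain ⟨g₁, hg₁, hg₁'⟩ := exists_between hg
  obtain ⟨f, ⟨v, hv, rfl⟩, b, hb, h⟩ := exists_comparator (ν := μ) (κ := κ) (g := g) (g₁ := g₁)
    (C := {f | ∃ v : Weighting H, ‖v‖ ≤ 1 ∧ f = fun z => -negMargin v z}) hκ0 hκ1
    (by rintro _ ⟨v, -, rfl⟩; exact (measurable_negMargin hmeas v).neg)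
    (by
      rintro _ ⟨v, hv, rfl⟩ z
      rw [abs_neg]; exact (abs_negMargin_le hbin v z).trans hv)
    (by
      rintro _ ⟨v, hv, rfl⟩ _ ⟨v', hv', rfl⟩ τ ⟨hτ0, hτ1⟩
      refine ⟨(1 - τ) • v + τ • v', ?_, ?_⟩
      · refine (norm_add_le _ _).trans ?_
        rw [norm_smul, norm_smul, Real.norm_eq_abs, Real.norm_eq_abs, abs_of_nonneg hτ0,
          abs_of_nonneg (by linarith : 0 ≤ 1 - τ)]
        nlinarith
      · funext z
        rw [negMargin_add hbin, negMargin_smul, negMargin_smul]; ring)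
    (by
      intro p hp h0 h1 h2
      have hpd : p ∈ densities κ μ := mem_densities hκ0 hp h0 h1 h2
      have : Nonempty {w : Weighting H // ‖w‖ ≤ 1} := ⟨⟨0, by simp⟩⟩
      obtain ⟨w, hw⟩ := exists_lt_of_lt_ciSup (hg₁'.trans_le (gam_le κ hpd))
      refine ⟨_, ⟨w.1, w.2, rfl⟩, hw.le.trans (le_of_eq ?_)⟩
      rw [← integral_neg]
      congr 1; funext z; ring)
    hg₁
  refine ⟨v, hv, b, hb, h.trans (le_of_eq ?_)⟩
  simp only [sub_neg_eq_add]

end Gam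

/-! ### A Chernoff bound -/

lemma exp_le_cubic {x : ℝ} (h0 : 0 ≤ x) (h1 : x ≤ 1 / 2) :
    Real.exp x ≤ 1 + x * (1 + x / 2 + x ^ 2 / 5) := by
  have h := Real.exp_bound' h0 (by linarith : x ≤ 1) (n := 4) (by norm_num)
  simp only [Finset.sum_range_succ, Finset.sum_range_zero, Nat.factorial] at h
  norm_num at h
  have h3 : 0 ≤ x ^ 3 * (1 / 2 - x) := mul_nonneg (by positivity) (by linarith)
  have h4 : 0 ≤ x ^ 3 := by positivity
  nlinarith

section Chernoff

variable {Z : Type*} [MeasurableSpace Z] {μ : Measure Z} [IsProbabilityMeasure μ]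

/-- Bennett's form of the Chernoff bound for the mean of independent copies of a variable with
values in `[0, 2]`, with a free parameter `x` trading the relative against the absolute error. -/
lemma measure_mean_gt_le {u : Z → ℝ} (hu : Measurable u) (hu0 : ∀ z, 0 ≤ u z)
    (hu2 : ∀ z, u z ≤ 2) {m : ℕ} (hm : 0 < m) {x L : ℝ} (hx0 : 0 < x) (hx1 : x ≤ 1 / 2) :
    Measure.pi (fun _ : Fin m => μ) {S | (1 + x / 2 + x ^ 2 / 5) * (∫ z, u z ∂μ) +
        2 * L / (x * m) < (1 / (m : ℝ)) * ∑ i, u (S i)} ≤ ENNReal.ofReal (Real.exp (-L)) := by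
  have hm' : (0 : ℝ) < m := by exact_mod_cast hm
  set E := ∫ z, u z ∂μ with hE
  have hE0 : 0 ≤ E := integral_nonneg hu0
  set ψ := 1 + x / 2 + x ^ 2 / 5 with hψ
  have hIu : Integrable u μ := by
    refine Integrable.of_bound hu.aestronglyMeasurable 2 (ae_of_all _ fun z => ?_)
    rw [Real.norm_eq_abs, abs_of_nonneg (hu0 z)]; exact hu2 z
  have hpt : ∀ z, Real.exp (x / 2 * u z) ≤ 1 + (Real.exp x - 1) / 2 * u z := by
    intro z
    have h := convexOn_exp.2 (Set.mem_univ 0) (Set.mem_univ x)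
      (by linarith [hu2 z] : 0 ≤ 1 - u z / 2) (by linarith [hu0 z] : 0 ≤ u z / 2) (by ring)
    simp only [smul_eq_mul, mul_zero, zero_add, Real.exp_zero] at h
    have e : u z / 2 * x = x / 2 * u z := by ring
    rw [e] at h
    linarith
  have hmgf : ∫ z, Real.exp (x / 2 * u z) ∂μ ≤ Real.exp (x / 2 * ψ * E) := by
    calc ∫ z, Real.exp (x / 2 * u z) ∂μ
        ≤ ∫ z, (1 + (Real.exp x - 1) / 2 * u z) ∂μ := by
          refine integral_mono ?_ ((integrable_const _).add (hIu.const_mul _)) hpt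
          refine Integrable.of_bound
            (Real.measurable_exp.comp (hu.const_mul _)).aestronglyMeasurable (Real.exp x)
            (ae_of_all _ fun z => ?_)
          rw [Real.norm_eq_abs, abs_of_pos (Real.exp_pos _)]
          exact Real.exp_le_exp.2 (by nlinarith [hu2 z])
      _ = 1 + (Real.exp x - 1) / 2 * E := by
          rw [integral_add (integrable_const _) (hIu.const_mul _), integral_const_mul, ← hE]; simp
      _ ≤ 1 + x / 2 * ψ * E := by
          have h := exp_le_cubic hx0.le hx1
          rw [← hψ] at h
          have := mul_le_mul_of_nonneg_right (by linarith : (Real.exp x - 1) / 2 ≤ x / 2 * ψ) hE0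
          linarith
      _ ≤ Real.exp (x / 2 * ψ * E) := by
          rw [add_comm]; exact Real.add_one_le_exp _
  set F : (Fin m → Z) → ℝ := fun S => ∏ i, Real.exp (x / 2 * u (S i)) with hF
  have hFm : Measurable F := Finset.measurable_prod _ fun i _ =>
    Real.measurable_exp.comp ((hu.comp (measurable_pi_apply i)).const_mul _)
  have hF0 : ∀ S, 0 ≤ F S := fun S => Finset.prod_nonneg fun i _ => (Real.exp_pos _).le
  have hFI : Integrable F (Measure.pi fun _ : Fin m => μ) := by
    refine Integrable.of_bound hFm.aestronglyMeasurable (∏ _i : Fin m, Real.exp x)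
      (ae_of_all _ fun S => ?_)
    rw [Real.norm_eq_abs, abs_of_nonneg (hF0 S)]
    exact Finset.prod_le_prod (fun i _ => (Real.exp_pos _).le) fun i _ =>
      Real.exp_le_exp.2 (by nlinarith [hu2 (S i)])
  have hFint : ∫ S, F S ∂(Measure.pi fun _ : Fin m => μ) ≤ Real.exp (m * (x / 2 * ψ * E)) := by
    rw [hF, integral_fintype_prod_eq_prod (fun _ z => Real.exp (x / 2 * u z)), Finset.prod_const,
      Finset.card_univ, Fintype.card_fin, Real.exp_nat_mul]
    exact pow_le_pow_left₀ (integral_nonneg fun z => (Real.exp_pos _).le) hmgf m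
  have hmarkov := mul_meas_ge_le_integral_of_nonneg (ae_of_all _ hF0) hFI
    (Real.exp (m * (x / 2 * ψ * E) + L))
  have hreal : (Measure.pi fun _ : Fin m => μ).real
      {S | Real.exp (m * (x / 2 * ψ * E) + L) ≤ F S} ≤ Real.exp (-L) := by
    have h1 := hmarkov.trans hFint
    have e : Real.exp (m * (x / 2 * ψ * E)) =
        Real.exp (m * (x / 2 * ψ * E) + L) * Real.exp (-L) := by
      rw [← Real.exp_add]; congr 1; ring
    rw [e] at h1
    exact le_of_mul_le_mul_left h1 (Real.exp_pos _)
  refine (measure_mono fun S hS => ?_).trans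
    ((ofReal_measureReal (measure_ne_top _ _)).symm.le.trans (ENNReal.ofReal_le_ofReal hreal))
  simp only [Set.mem_ofPred_eq, hF] at hS ⊢
  rw [← Real.exp_sum, Real.exp_le_exp, ← Finset.mul_sum]
  have h1 := mul_lt_mul_of_pos_left hS (by positivity : 0 < m * (x / 2))
  have e1 : (m : ℝ) * (x / 2) * (ψ * E + 2 * L / (x * m)) = m * (x / 2 * ψ * E) + L := by
    field_simp
  have e2 : (m : ℝ) * (x / 2) * (1 / m * ∑ i, u (S i)) = x / 2 * ∑ i, u (S i) := by
    field_simp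
  rw [e1, e2] at h1
  exact h1.le

end Chernoff

/-! ### Weighted margins of the comparator on a sample -/

/-- The free parameter of the Chernoff bound.  For `M ≤ 5 * K / (ε * b)` the weights are controlled
by their maximum `M` and the relative error must be of the order of `g / b`; otherwise they are
controlled by their second moment `2 * K`, and a constant relative error suffices. -/
noncomputable def chernoffParam (M K ε b g : ℝ) : ℝ :=
  open Classical in if M * (ε * b) ≤ 5 * K then g / (2 * b) else 7 / 20

lemma chernoffParam_pos {M K ε b g : ℝ} (hg : 0 < g) (hgb : g ≤ b) :
    0 < chernoffParam M K ε b g := by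
  have : 0 < b := hg.trans_le hgb
  unfold chernoffParam
  split_ifs
  · positivity
  · norm_num

lemma chernoffParam_le {M K ε b g : ℝ} (hg : 0 < g) (hgb : g ≤ b) :
    chernoffParam M K ε b g ≤ 1 / 2 := by
  have : 0 < b := hg.trans_le hgb
  unfold chernoffParam
  split_ifs
  · rw [div_le_div_iff₀ (by positivity) (by norm_num)]; linarith
  · norm_num

/-- The bound on the mean weighted shortfall through the maximum of the weights. -/
lemma max_mul_mean_shortfall_le {m P M K ε b g γ E L : ℝ} (hm : 0 < m) (hM : 0 < M) (hK : 0 < K)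
    (hε : 0 < ε) (hg : 0 < g) (hgb : g ≤ b) (hγ0 : 0 < γ) (hγ : γ ≤ 1.001 * g) (hL : 0 < L)
    (hE : M * E ≤ ε * (b - g)) (hmL : 96 * K * L ≤ m * (ε * γ) ^ 2) (hc : M * (ε * b) ≤ 5 * K)
    (hP : P ≤ (1 + g / (2 * b) / 2 + (g / (2 * b)) ^ 2 / 5) * E + 2 * L / (g / (2 * b) * m)) :
    M * P ≤ ε * (b - γ / 2) := by
  have hb : 0 < b := hg.trans_le hgb
  have hLm : L / m ≤ (ε * γ) ^ 2 / (96 * K) := by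
    rw [div_le_div_iff₀ hm (by positivity)]; linarith
  have hγ2 : γ ^ 2 ≤ 1.003 * g ^ 2 := by nlinarith
  have hεg : 0 < ε * g := by positivity
  have hfluct : M * (2 * L / (g / (2 * b) * m)) ≤ 0.21 * (ε * g) := by
    have e : M * (2 * L / (g / (2 * b) * m)) = 4 * (M * b / g) * (L / m) := by field_simp; ring
    rw [e]
    have h1 : M * b ≤ 5 * K / ε := by rw [le_div_iff₀ hε]; linarith
    calc 4 * (M * b / g) * (L / m)
        ≤ 4 * (5 * K / ε / g) * ((ε * γ) ^ 2 / (96 * K)) := by gcongr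
      _ = 20 / 96 * ε * (γ ^ 2 / g) := by field_simp; norm_num
      _ ≤ 20 / 96 * ε * (1.003 * g ^ 2 / g) := by gcongr
      _ = 20 / 96 * 1.003 * (ε * g) := by field_simp
      _ ≤ 0.21 * (ε * g) := by linarith
  have hrel : (1 + g / (2 * b) / 2 + (g / (2 * b)) ^ 2 / 5) * (b - g) ≤ b - 0.75 * g := by
    have e : (1 + g / (2 * b) / 2 + (g / (2 * b)) ^ 2 / 5) * (b - g) =
        b - 0.75 * g - (0.2 * (g ^ 2 / b) + 0.05 * (g ^ 3 / b ^ 2)) := by field_simp; ring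
    rw [e]
    have : 0 ≤ 0.2 * (g ^ 2 / b) + 0.05 * (g ^ 3 / b ^ 2) := by positivity
    linarith
  calc M * P ≤ M * ((1 + g / (2 * b) / 2 + (g / (2 * b)) ^ 2 / 5) * E +
        2 * L / (g / (2 * b) * m)) := mul_le_mul_of_nonneg_left hP hM.le
    _ = (1 + g / (2 * b) / 2 + (g / (2 * b)) ^ 2 / 5) * (M * E) +
        M * (2 * L / (g / (2 * b) * m)) := by ring
    _ ≤ (1 + g / (2 * b) / 2 + (g / (2 * b)) ^ 2 / 5) * (ε * (b - g)) + 0.21 * (ε * g) := by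
        gcongr
    _ = ε * ((1 + g / (2 * b) / 2 + (g / (2 * b)) ^ 2 / 5) * (b - g)) + 0.21 * (ε * g) := by ring
    _ ≤ ε * (b - 0.75 * g) + 0.21 * (ε * g) := by gcongr
    _ = ε * (b - 0.54 * g) := by ring
    _ ≤ ε * (b - γ / 2) := mul_le_mul_of_nonneg_left (by linarith) hε.le

/-- The bound on the mean weighted shortfall through the second moment of the weights. -/
lemma second_moment_mul_mean_shortfall_le {m P M K ε b g γ E L : ℝ} (hm : 0 < m) (hK : 0 < K)
    (hε : 0 < ε) (hg : 0 < g) (hgb : g ≤ b) (hγ0 : 0 < γ) (hγ : γ ≤ 1.001 * g)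
    (hE : M * E ≤ ε * (b - g)) (hmL : 96 * K * L ≤ m * (ε * γ) ^ 2) (hc : 5 * K < M * (ε * b))
    (hP : P ≤ (1 + 7 / 20 / 2 + (7 / 20) ^ 2 / 5) * E + 2 * L / (7 / 20 * m)) :
    4 * K * P ≤ (ε * (b - γ / 2)) ^ 2 := by
  have hb : 0 < b := hg.trans_le hgb
  have hLm : L / m ≤ (ε * γ) ^ 2 / (96 * K) := by
    rw [div_le_div_iff₀ hm (by positivity)]; linarith
  have hγ2 : γ ^ 2 ≤ 1.003 * g ^ 2 := by nlinarith
  have hεg : 0 < ε ^ 2 * g ^ 2 := by positivity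
  have hbg := sub_nonneg.2 hgb
  have hnn : 0 ≤ ε ^ 2 * (b * (b - g)) := by positivity
  have hE' : K * E ≤ ε ^ 2 * (b * (b - g)) / 5 := by
    rcases le_or_gt E 0 with h | h
    · have : K * E ≤ 0 := mul_nonpos_of_nonneg_of_nonpos hK.le h
      linarith
    · have h1 := mul_le_mul_of_nonneg_right hc.le h.le
      have h2 := mul_le_mul_of_nonneg_left hE (by positivity : 0 ≤ ε * b)
      have e1 : M * (ε * b) * E = ε * b * (M * E) := by ring
      have e2 : ε * b * (ε * (b - g)) = ε ^ 2 * (b * (b - g)) := by ring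
      rw [e1] at h1; rw [e2] at h2
      linarith
  have hfluct : 4 * K * (2 * L / (7 / 20 * m)) ≤ 0.24 * (ε ^ 2 * g ^ 2) := by
    have e : 4 * K * (2 * L / (7 / 20 * m)) = 160 / 7 * K * (L / m) := by field_simp; ring
    rw [e]
    calc 160 / 7 * K * (L / m) ≤ 160 / 7 * K * ((ε * γ) ^ 2 / (96 * K)) := by gcongr
      _ = 160 / (7 * 96) * ε ^ 2 * γ ^ 2 := by field_simp
      _ ≤ 160 / (7 * 96) * ε ^ 2 * (1.003 * g ^ 2) := by gcongr
      _ = 160 / (7 * 96) * 1.003 * (ε ^ 2 * g ^ 2) := by ring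
      _ ≤ 0.24 * (ε ^ 2 * g ^ 2) := by linarith
  calc 4 * K * P ≤ 4 * K * ((1 + 7 / 20 / 2 + (7 / 20) ^ 2 / 5) * E + 2 * L / (7 / 20 * m)) :=
        mul_le_mul_of_nonneg_left hP (by positivity)
    _ = 4.798 * (K * E) + 4 * K * (2 * L / (7 / 20 * m)) := by ring
    _ ≤ 4.798 * (ε ^ 2 * (b * (b - g)) / 5) + 0.24 * (ε ^ 2 * g ^ 2) := by gcongr
    _ ≤ 0.96 * (ε ^ 2 * (b * (b - g))) + 0.24 * (ε ^ 2 * g ^ 2) := by linarith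
    _ = ε ^ 2 * (0.96 * (b * (b - g)) + 0.24 * g ^ 2) := by ring
    _ ≤ ε ^ 2 * (b - 0.5005 * g) ^ 2 := by
        refine mul_le_mul_of_nonneg_left ?_ (by positivity)
        nlinarith [mul_nonneg hbg hbg, mul_nonneg hg.le hbg]
    _ ≤ ε ^ 2 * (b - γ / 2) ^ 2 := by
        refine mul_le_mul_of_nonneg_left ?_ (by positivity)
        exact pow_le_pow_left₀ (by linarith) (by linarith) 2
    _ = (ε * (b - γ / 2)) ^ 2 := by ring

/-- Let `r` be weights of mean at least `ε`, maximum at most `M` and second moment at most `2 * K`,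
and let the shortfalls `u` of the margins `f` below the level `b` have the mean that the Chernoff
bound predicts.  Then the weighted mean margin is at least `ε * γ / 2`. -/
lemma weighted_margin_ge {m : ℕ} (hm : 0 < m) {r u f : Fin m → ℝ}
    {M K ε b g γ E L : ℝ} (hM : 0 < M) (hK : 0 < K) (hε : 0 < ε) (hg : 0 < g) (hgb : g ≤ b)
    (hγ0 : 0 < γ) (hγ : γ ≤ 1.001 * g) (hL : 0 < L) (hE : M * E ≤ ε * (b - g))
    (hmL : 96 * K * L ≤ m * (ε * γ) ^ 2)
    (hr0 : ∀ i, 0 ≤ r i) (hrM : ∀ i, r i ≤ M) (hr : ε ≤ (1 / (m : ℝ)) * ∑ i, r i)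
    (hr2 : (1 / (m : ℝ)) * ∑ i, r i ^ 2 ≤ 2 * K)
    (hu0 : ∀ i, 0 ≤ u i) (hu2 : ∀ i, u i ≤ 2) (hf : ∀ i, b - u i ≤ f i)
    (hP : (1 / (m : ℝ)) * ∑ i, u i ≤ (1 + chernoffParam M K ε b g / 2 +
      chernoffParam M K ε b g ^ 2 / 5) * E + 2 * L / (chernoffParam M K ε b g * m)) :
    ε * γ / 2 ≤ (1 / (m : ℝ)) * ∑ i, r i * f i := by
  have hm' : (0 : ℝ) < m := by exact_mod_cast hm
  have hb : 0 < b := hg.trans_le hgb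
  set P := (1 / (m : ℝ)) * ∑ i, u i with hPdef
  set Q := (1 / (m : ℝ)) * ∑ i, r i * u i with hQdef
  -- it suffices to bound the weighted shortfall
  suffices hQ : Q ≤ ε * (b - γ / 2) by
    have h1 : (1 / (m : ℝ)) * ∑ i, (b * r i - r i * u i) ≤ (1 / (m : ℝ)) * ∑ i, r i * f i := by
      refine mean_mono fun i => ?_
      have := mul_le_mul_of_nonneg_left (hf i) (hr0 i)
      linarith
    rw [Finset.sum_sub_distrib, ← Finset.mul_sum, mul_sub] at h1
    have h2 := mul_le_mul_of_nonneg_left hr hb.le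
    have e : 1 / (m : ℝ) * (b * ∑ i, r i) = b * (1 / (m : ℝ) * ∑ i, r i) := by ring
    rw [e] at h1
    linarith
  by_cases hc : M * (ε * b) ≤ 5 * K
  · have hx : chernoffParam M K ε b g = g / (2 * b) := if_pos hc
    rw [hx] at hP
    have hQ1 : Q ≤ M * P := by
      have : Q ≤ (1 / (m : ℝ)) * ∑ i, M * u i :=
        mean_mono fun i => mul_le_mul_of_nonneg_right (hrM i) (hu0 i)
      rw [← Finset.mul_sum] at this
      linarith
    exact hQ1.trans (max_mul_mean_shortfall_le hm' hM hK hε hg hgb hγ0 hγ hL hE hmL hc hP)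
  · have hx : chernoffParam M K ε b g = 7 / 20 := if_neg hc
    rw [hx] at hP
    -- by the Cauchy–Schwarz inequality
    have hQ1 : Q ^ 2 ≤ 4 * K * P := by
      have h1 := Finset.sum_mul_sq_le_sq_mul_sq Finset.univ r u
      have h2 : (1 / (m : ℝ)) * ∑ i, u i ^ 2 ≤ 2 * P := by
        have : (1 / (m : ℝ)) * ∑ i, u i ^ 2 ≤ (1 / (m : ℝ)) * ∑ i, 2 * u i :=
          mean_mono fun i => by nlinarith [hu0 i, hu2 i]
        rw [← Finset.mul_sum] at this
        linarith
      calc Q ^ 2 = (1 / (m : ℝ)) ^ 2 * (∑ i, r i * u i) ^ 2 := by rw [hQdef, mul_pow]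
        _ ≤ (1 / (m : ℝ)) ^ 2 * ((∑ i, r i ^ 2) * ∑ i, u i ^ 2) := by gcongr
        _ = ((1 / (m : ℝ)) * ∑ i, r i ^ 2) * ((1 / (m : ℝ)) * ∑ i, u i ^ 2) := by ring
        _ ≤ (2 * K) * (2 * P) := by
          refine mul_le_mul hr2 h2 ?_ (by positivity)
          exact mul_nonneg (by positivity) (Finset.sum_nonneg fun i _ => sq_nonneg _)
        _ = 4 * K * P := by ring
    have hpos : 0 ≤ b - γ / 2 := by linarith
    exact abs_le_of_sq_le_sq' (hQ1.trans (second_moment_mul_mean_shortfall_le hm' hK hε hg hgb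
      hγ0 hγ hE hmL (not_le.1 hc) hP)) (by positivity) |>.2

/-! ### The empirical classification risk of the output -/

section Output

variable {X : Type*} {H : Set (X → ℝ)} {m : ℕ} {ℓ : ℝ → ℝ} {β₁ β₂ B₂ : ℝ}

/-- Misclassified sample points carry a weight of at least `β₁`. -/
lemma empRisk_le_mean_weight (hℓ : IsBdsLoss ℓ β₁ β₂ B₂) (S : Fin m → X × Bool)
    (w : Weighting H) :
    empRisk S w ≤ (1 / (m : ℝ)) * ∑ i, deriv ℓ (negMargin w (S i)) / β₁ := by
  refine mean_mono fun i => ?_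
  have hβ := hℓ.beta_pos
  by_cases h : zeroOne (vote w (S i).1) (S i).2 = 0
  · rw [h]; exact div_nonneg (hℓ.deriv_mem _).1 hβ.le
  · refine (zeroOne_le_one _ _).trans ((one_le_div hβ).2 ?_)
    exact (hℓ.deriv_mem_of_nonneg _ (negMargin_nonneg_of_zeroOne_ne_zero w (S i) h)).1

lemma empSurrogateRisk_pos_of_empRisk_pos (hℓ : IsBdsLoss ℓ β₁ β₂ B₂) {S : Fin m → X × Bool}
    {w : Weighting H} (h : 0 < empRisk S w) : 0 < empSurrogateRisk ℓ S w := by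
  have h1 : ℓ 0 * empRisk S w ≤ empSurrogateRisk ℓ S w := by
    have : (1 / (m : ℝ)) * ∑ i, ℓ 0 * zeroOne (vote w (S i).1) (S i).2 ≤
        empSurrogateRisk ℓ S w := by
      refine mean_mono fun i => ?_
      by_cases h : zeroOne (vote w (S i).1) (S i).2 = 0
      · rw [h, mul_zero]; exact hℓ.nonneg _
      · exact (mul_le_of_le_one_right hℓ.pos_zero.le (zeroOne_le_one _ _)).trans
          (hℓ.mono (negMargin_nonneg_of_zeroOne_ne_zero w (S i) h))
    rw [← Finset.mul_sum] at this
    rw [empRisk]; linarith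
  exact (mul_pos hℓ.pos_zero h).trans_le h1

/-- If weights of mean at least `ε` always leave a slope of order `γ`, the output has
empirical classification risk at most `ε`: otherwise all iterates would misclassify a fraction
`ε` of the sample, and the surrogate risk would have decreased below `0`. -/
lemma IsBoostOutput.empRisk_le (hbin : ∀ h ∈ H, ∀ x, h x = 1 ∨ h x = -1)
    (hℓ : IsBdsLoss ℓ β₁ β₂ B₂) {a ρ ε γ : ℝ} (hm : 0 < m) (hρ : 0 < ρ) (hε0 : 0 < ε)
    (hε1 : ε ≤ 1) (hγ : 0 < γ) {S : Fin m → X × Bool}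
    (hiter : 24 * B₂ * ℓ 0 / (ρ * β₁ * ε * γ) ^ 2 ≤ (m : ℝ) ^ a)
    (hS : ∀ w : Weighting H, empSurrogateRisk ℓ S w ≤ ℓ 0 →
      ε ≤ (1 / (m : ℝ)) * ∑ i, deriv ℓ (negMargin w (S i)) / β₁ →
      β₁ * (ε * γ / 2) ≤ maxSlope ℓ S w)
    {w : Weighting H} (h : IsBoostOutput ℓ B₂ ρ a S w) : empRisk S w ≤ ε := by
  have hβ := hℓ.beta_pos
  have hB := hℓ.smoothness_pos
  have hm' : (0 : ℝ) < m := by exact_mod_cast hm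
  have hmean : ∀ c : ℝ, (1 / (m : ℝ)) * ∑ _i : Fin m, c = c := fun c => by
    rw [Finset.sum_const, Finset.card_univ, Fintype.card_fin, nsmul_eq_mul]; field_simp
  obtain ⟨it, h0, hstep, i, hi, hmin, rfl⟩ := h
  set T := ⌈(m : ℝ) ^ a⌉₊ with hT
  by_contra hc
  push Not at hc
  have hinit : empSurrogateRisk ℓ S (it 0) = ℓ 0 := by
    simp only [h0, empSurrogateRisk, negMargin_zero, hmean]
  have hfin := empSurrogateRisk_iterate_le hbin hℓ hρ.le
    (by positivity : 0 ≤ β₁ * (ε * γ / 2)) hstep fun t ht hle => by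
      refine hS (it t) (by rw [← hinit]; exact hle) ?_
      rcases Nat.eq_zero_or_pos t with rfl | ht0
      · simp only [h0, negMargin_zero, hmean]
        exact hε1.trans ((one_le_div hβ).2 (hℓ.deriv_mem_of_nonneg 0 le_rfl).1)
      · exact hc.le.trans ((hmin t (Finset.mem_Icc.2 ⟨ht0, ht.le⟩)).trans
          (empRisk_le_mean_weight hℓ S (it t)))
  have hT1 : 1 ≤ T := by
    have := Finset.mem_Icc.1 hi; omega
  have hpos := empSurrogateRisk_pos_of_empRisk_pos hℓ
    (hε0.trans (hc.trans_le (hmin T (Finset.mem_Icc.2 ⟨hT1, le_rfl⟩))))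
  have hTle : 24 * B₂ * ℓ 0 / (ρ * β₁ * ε * γ) ^ 2 ≤ T := hiter.trans (Nat.le_ceil _)
  have hdrop : ℓ 0 ≤ T * ((ρ * (β₁ * (ε * γ / 2))) ^ 2 / (6 * B₂)) := by
    rw [div_le_iff₀ (by positivity)] at hTle
    rw [← mul_div_assoc, le_div_iff₀ (by positivity)]
    nlinarith
  rw [hinit] at hfin
  linarith

end Output

section Slope

variable {X : Type*} [MeasurableSpace X] {H : Set (X → ℝ)} {m : ℕ} {ℓ : ℝ → ℝ}
  {β₁ β₂ B₂ : ℝ} {μ : Measure (X × Bool)} [IsProbabilityMeasure μ]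

/-- With high probability, weights of mean at least `ε` leave a slope of order `γ`.  The
derivative of the loss at sample points is bounded by `β₂`, but its mean square is at most
`2 * B₂ * ℓ 0` along the iterations, and the sample has to be large only in terms of the latter. -/
lemma measure_not_large_slope_le (hbin : ∀ h ∈ H, ∀ x, h x = 1 ∨ h x = -1)
    (hmeas : ∀ h ∈ H, Measurable h) (hℓ : IsBdsLoss ℓ β₁ β₂ B₂) {ε γ L : ℝ} (hε0 : 0 < ε)
    (hε1 : ε ≤ 1) (hγ0 : 0 < γ) (hγ : γ = gam H (ε * β₁ / β₂) μ) (hm : 0 < m) (hL : 0 < L)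
    (hmL : 96 * (B₂ * ℓ 0 / β₁ ^ 2) * L ≤ m * (ε * γ) ^ 2) :
    Measure.pi (fun _ : Fin m => μ) {S | ¬ ∀ w : Weighting H, empSurrogateRisk ℓ S w ≤ ℓ 0 →
      ε ≤ (1 / (m : ℝ)) * ∑ i, deriv ℓ (negMargin w (S i)) / β₁ →
      β₁ * (ε * γ / 2) ≤ maxSlope ℓ S w} ≤ ENNReal.ofReal (Real.exp (-L)) := by
  have hβ := hℓ.beta_pos
  have hβ₂ : 0 < β₂ := hβ.trans_le hℓ.beta_le
  have hB := hℓ.smoothness_pos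
  have hl0 := hℓ.pos_zero
  set κ := ε * β₁ / β₂ with hκ
  have hκ0 : 0 < κ := by positivity
  have hκ1 : κ ≤ 1 := by
    rw [hκ, div_le_one hβ₂]
    exact (mul_le_of_le_one_left hβ.le hε1).trans hℓ.beta_le
  -- the supremum over weightings need not be attained; the later estimates leave room for `1.001`
  set g := γ / 1.001 with hg
  have hg0 : 0 < g := by positivity
  obtain ⟨v, hv, b, hb, hbg⟩ := exists_comparator_weighting (μ := μ) hbin hmeas hκ0 hκ1
    (show g < gam H κ μ by rw [← hγ, hg]; exact div_lt_self hγ0 (by norm_num))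
  set u : X × Bool → ℝ := fun z => max (b + negMargin v z) 0 with hu
  have hum : Measurable u := ((measurable_negMargin hmeas v).const_add b).max measurable_const
  have hu0 : ∀ z, 0 ≤ u z := fun z => le_max_right _ _
  have hu2 : ∀ z, u z ≤ 2 := fun z => by
    have := (abs_le.1 ((abs_negMargin_le hbin v z).trans hv)).2
    exact max_le (by linarith) (by norm_num)
  have hE0 : 0 ≤ ∫ z, u z ∂μ := integral_nonneg hu0
  have hgb : g ≤ b := by
    have : 0 ≤ 1 / κ * ∫ z, u z ∂μ := by positivity
    linarith
  have hE : β₂ / β₁ * ∫ z, u z ∂μ ≤ ε * (b - g) := by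
    have h1 : 1 / κ * ∫ z, u z ∂μ ≤ b - g := by linarith
    have h2 := mul_le_mul_of_nonneg_left h1 hε0.le
    refine le_trans (le_of_eq ?_) h2
    rw [hκ]; field_simp
  set K := B₂ * ℓ 0 / β₁ ^ 2 with hK
  have hK0 : 0 < K := by positivity
  have hx0 : 0 < chernoffParam (β₂ / β₁) K ε b g := chernoffParam_pos hg0 hgb
  refine (measure_mono fun S hS => ?_).trans
    (measure_mean_gt_le hum hu0 hu2 hm hx0 (chernoffParam_le hg0 hgb))
  by_contra hP
  refine hS fun w hw hmean => ?_
  simp only [Set.mem_ofPred_eq, not_lt] at hP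
  have key := weighted_margin_ge hm (r := fun i => deriv ℓ (negMargin w (S i)) / β₁)
    (u := fun i => u (S i)) (f := fun i => -negMargin v (S i)) (div_pos hβ₂ hβ) hK0 hε0 hg0 hgb
    hγ0 (by rw [hg]; exact (mul_div_cancel₀ _ (by norm_num)).ge) hL hE hmL
    (fun i => div_nonneg (hℓ.deriv_mem _).1 hβ.le)
    (fun i => div_le_div_of_nonneg_right (hℓ.deriv_mem _).2 hβ.le) hmean
    (by
      have h1 : (1 / (m : ℝ)) * ∑ i, (deriv ℓ (negMargin w (S i)) / β₁) ^ 2 ≤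
          (1 / (m : ℝ)) * ∑ i, 2 * B₂ / β₁ ^ 2 * ℓ (negMargin w (S i)) := by
        refine mean_mono fun i => ?_
        rw [div_pow, div_mul_eq_mul_div]
        exact div_le_div_of_nonneg_right (hℓ.sq_deriv_le _) (by positivity)
      rw [← Finset.mul_sum] at h1
      have h2 : 2 * B₂ / β₁ ^ 2 * empSurrogateRisk ℓ S w ≤ 2 * B₂ / β₁ ^ 2 * ℓ 0 := by gcongr
      have e : 2 * B₂ / β₁ ^ 2 * ℓ 0 = 2 * K := by rw [hK]; ring
      rw [e, empSurrogateRisk] at h2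
      linarith)
    (fun i => hu0 _) (fun i => hu2 _)
    (fun i => by
      have := le_max_left (b + negMargin v (S i)) 0
      simp only [hu]; linarith) hP
  refine le_trans ?_ (neg_slope_le hbin hℓ S w v hv)
  have e : -slope ℓ S w v =
      β₁ * ((1 / (m : ℝ)) * ∑ i, deriv ℓ (negMargin w (S i)) / β₁ * -negMargin v (S i)) := by
    rw [slope, ← mul_neg, ← Finset.sum_neg_distrib, mul_left_comm, Finset.mul_sum (a := β₁)]
    congr 1
    refine Finset.sum_congr rfl fun i _ => ?_
    field_simp
  rw [e]
  exact mul_le_mul_of_nonneg_left key hβ.le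

end Slope

/-! ### Counting traces -/

section Traces

variable {Z ι : Type*} [Fintype ι]

open Classical in
/-- The sets of indices that the members of a family of sets cut out of a finite family of
points. -/
noncomputable def traces (F : Set (Set Z)) (z : ι → Z) : Finset (Finset ι) :=
  Finset.univ.filter fun t => ∃ A ∈ F, ∀ i, i ∈ t ↔ z i ∈ A

lemma mem_traces {F : Set (Set Z)} {z : ι → Z} {t : Finset ι} :
    t ∈ traces F z ↔ ∃ A ∈ F, ∀ i, i ∈ t ↔ z i ∈ A := by
  simp [traces]

/-- The Sauer–Shelah lemma with a simple bound on the sum of binomial coefficients. -/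
lemma card_le_of_shatters_card_le [DecidableEq ι] {𝒜 : Finset (Finset ι)} {d : ℕ}
    (h : ∀ s, 𝒜.Shatters s → s.card ≤ d) : 𝒜.card ≤ (Fintype.card ι + 1) ^ d := by
  have hd : 𝒜.vcDim ≤ d := Finset.sup_le fun s hs => h s (Finset.mem_shatterer.1 hs)
  calc 𝒜.card ≤ 𝒜.shatterer.card := 𝒜.card_le_card_shatterer
    _ ≤ ∑ k ∈ Finset.Iic 𝒜.vcDim, (Fintype.card ι).choose k :=
        Finset.card_shatterer_le_sum_vcDim
    _ ≤ ∑ k ∈ Finset.range (d + 1), (Fintype.card ι).choose k := by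
        refine Finset.sum_le_sum_of_subset fun k hk => ?_
        rw [Finset.mem_Iic] at hk
        rw [Finset.mem_range]; omega
    _ ≤ ∑ k ∈ Finset.range (d + 1), Fintype.card ι ^ k * 1 ^ (d - k) * d.choose k := by
        refine Finset.sum_le_sum fun k hk => ?_
        have hk' : k ≤ d := by rw [Finset.mem_range] at hk; omega
        calc (Fintype.card ι).choose k ≤ Fintype.card ι ^ k := Nat.choose_le_pow _ _
          _ ≤ Fintype.card ι ^ k * 1 ^ (d - k) * d.choose k := by
            rw [one_pow, mul_one]
            exact Nat.le_mul_of_pos_right _ (Nat.choose_pos hk')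
    _ = (Fintype.card ι + 1) ^ d := (add_pow _ _ _).symm

lemma card_traces_class_le {X : Type*} {H : Set (X → ℝ)} {V : ℕ} (hV : vcDim H = V)
    (x : ι → X) :
    (traces {A | ∃ h ∈ H, A = {x | h x = 1}} x).card ≤ (Fintype.card ι + 1) ^ V := by
  classical
  refine card_le_of_shatters_card_le fun s hs => ?_
  have hex : ∀ t ⊆ s, ∃ h ∈ H, ∀ i ∈ s, (h (x i) = 1 ↔ i ∈ t) := by
    intro t ht
    obtain ⟨u, hu, e⟩ := hs ht
    obtain ⟨_, ⟨h, hh, rfl⟩, hA⟩ := mem_traces.1 hu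
    refine ⟨h, hh, fun i hi => ?_⟩
    rw [← e, Finset.mem_inter, hA i]
    exact ⟨fun h' => ⟨hi, h'⟩, fun h' => h'.2⟩
  have hinj : Set.InjOn x s := by
    intro i hi j hj hij
    obtain ⟨h, -, hh⟩ := hex {i} (Finset.singleton_subset_iff.2 hi)
    have h1 := (hh i hi).2 (Finset.mem_singleton_self i)
    rw [hij] at h1
    exact (Finset.mem_singleton.1 ((hh j hj).1 h1)).symm
  have hsh : Shatters H (s.image x) := by
    intro t _
    obtain ⟨h, hH, hh⟩ := hex (s.filter fun i => x i ∈ t) (Finset.filter_subset _ _)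
    refine ⟨h, hH, fun y hy => ?_⟩
    obtain ⟨i, hi, rfl⟩ := Finset.mem_image.1 hy
    rw [hh i hi, Finset.mem_filter]
    exact ⟨fun h' => h'.2, fun h' => ⟨hi, h'⟩⟩
  have hle : ((s.image x).card : ℕ∞) ≤ vcDim H :=
    le_iSup₂ (f := fun (s : Finset X) (_ : Shatters H s) => (s.card : ℕ∞)) (s.image x) hsh
  rw [hV, Finset.card_image_of_injOn hinj] at hle
  exact_mod_cast hle

/-- Homogeneous closed half-spaces of `ℝ ^ T` have VC dimension at most `T`: a linear relation
between `T + 1` vectors excludes one of the sign patterns. -/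
lemma card_traces_halfspace_le {T : ℕ} (v : ι → Fin T → ℝ) :
    (traces {A | ∃ w : Fin T → ℝ, A = {y | 0 ≤ ∑ j, w j * y j}} v).card ≤
      (Fintype.card ι + 1) ^ T := by
  classical
  refine card_le_of_shatters_card_le fun s hs => ?_
  by_contra hc
  push Not at hc
  have hdep : ¬ LinearIndependent ℝ fun i : ↥s => v i := by
    intro hli
    have := hli.fintype_card_le_finrank
    simp only [Fintype.card_coe, Module.finrank_fintype_fun_eq_card, Fintype.card_fin] at this
    omega
  obtain ⟨c, hc0, i₀, hi₀⟩ : ∃ c : ↥s → ℝ, ∑ i, c i • v i = 0 ∧ ∃ i, 0 < c i := by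
    obtain ⟨c, h0, i, hi⟩ := Fintype.not_linearIndependent_iff.1 hdep
    rcases lt_or_gt_of_ne hi with h | h
    · refine ⟨-c, ?_, i, by simpa using h⟩
      rw [← neg_zero, ← h0, ← Finset.sum_neg_distrib]
      exact Finset.sum_congr rfl fun i _ => by simp
    · exact ⟨c, h0, i, h⟩
  obtain ⟨u, hu, e⟩ := hs (t := (Finset.univ.filter fun i : ↥s => c i ≤ 0).map
    (Function.Embedding.subtype _)) fun i hi => by
      obtain ⟨j, -, rfl⟩ := Finset.mem_map.1 hi
      exact j.2
  obtain ⟨_, ⟨w, rfl⟩, hA⟩ := mem_traces.1 hu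
  have hsign : ∀ i : ↥s, c i ≤ 0 ↔ 0 ≤ ∑ j, w j * v i j := by
    intro i
    have h1 := hA i
    rw [Set.mem_ofPred_eq] at h1
    rw [← h1]
    have h2 := Finset.ext_iff.1 e i
    simp only [Finset.mem_inter, Finset.mem_map, Finset.mem_filter, Finset.mem_univ, true_and,
      Function.Embedding.subtype_apply, Subtype.exists, exists_and_right, exists_eq_right,
      i.2, Subtype.coe_eta, exists_true_left] at h2
    exact h2.symm
  have hsum : ∑ i : ↥s, c i * ∑ j, w j * v i j = 0 := by
    have : ∑ i : ↥s, c i * ∑ j, w j * v i j = ∑ j, w j * (∑ i : ↥s, c i • v i) j := by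
      simp only [Finset.mul_sum, Finset.sum_apply, Pi.smul_apply, smul_eq_mul]
      rw [Finset.sum_comm]
      exact Finset.sum_congr rfl fun j _ => Finset.sum_congr rfl fun i _ => by ring
    rw [this, hc0]; simp
  have hneg : ∑ i : ↥s, c i * ∑ j, w j * v i j < ∑ _i : ↥s, (0 : ℝ) := by
    refine Finset.sum_lt_sum (fun i _ => ?_) ⟨i₀, Finset.mem_univ _, ?_⟩
    · rcases le_or_gt (c i) 0 with h | h
      · exact mul_nonpos_of_nonpos_of_nonneg h ((hsign i).1 h)
      · have : ∑ j, w j * v i j < 0 := not_le.1 fun h' => absurd ((hsign i).2 h') (not_le.2 h)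
        exact mul_nonpos_of_nonneg_of_nonpos h.le this.le
    · have : ∑ j, w j * v i₀ j < 0 := not_le.1 fun h' => absurd ((hsign i₀).2 h') (not_le.2 hi₀)
      exact mul_neg_of_pos_of_neg hi₀ this
  rw [hsum, Finset.sum_const_zero] at hneg
  exact lt_irrefl _ hneg

/-- The sets of labelled points misclassified by a weighted vote of `T` members of the class. -/
def errorSets {X : Type*} (H : Set (X → ℝ)) (T : ℕ) : Set (Set (X × Bool)) :=
  {A | ∃ (h : Fin T → X → ℝ) (w : Fin T → ℝ), (∀ j, h j ∈ H) ∧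
    A = {z | zeroOne (∑ j, w j * h j z.1) z.2 = 1}}

lemma zeroOne_eq_one_iff (v : ℝ) (y : Bool) : zeroOne v y = 1 ↔ (y = false ↔ 0 ≤ v) := by
  unfold zeroOne
  cases y <;> simp

lemma card_traces_errorSets_le {X : Type*} {H : Set (X → ℝ)}
    (hbin : ∀ h ∈ H, ∀ x, h x = 1 ∨ h x = -1) {V : ℕ} (hV : vcDim H = V) (T : ℕ)
    (z : ι → X × Bool) :
    (traces (errorSets H T) z).card ≤ (Fintype.card ι + 1) ^ ((V + 1) * T) := by
  classical
  set 𝒜 := traces {A | ∃ h ∈ H, A = {x | h x = 1}} fun i => (z i).1 with h𝒜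
  set 𝓑 : (Fin T → Finset ι) → Finset (Finset ι) := fun s =>
    traces {A | ∃ w : Fin T → ℝ, A = {y | 0 ≤ ∑ j, w j * y j}}
      fun i j => if i ∈ s j then (1 : ℝ) else -1 with h𝓑
  set φ : Finset ι → Finset ι := fun a =>
    Finset.univ.filter fun i => (z i).2 = false ↔ i ∈ a with hφ
  have hsub : traces (errorSets H T) z ⊆
      (Fintype.piFinset fun _ : Fin T => 𝒜).biUnion fun s => (𝓑 s).image φ := by
    intro t ht
    obtain ⟨_, ⟨h, w, hh, rfl⟩, hA⟩ := mem_traces.1 ht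
    refine Finset.mem_biUnion.2 ⟨fun j => Finset.univ.filter fun i => h j (z i).1 = 1, ?_, ?_⟩
    · refine Fintype.mem_piFinset.2 fun j => mem_traces.2 ⟨_, ⟨h j, hh j, rfl⟩, fun i => ?_⟩
      simp
    · refine Finset.mem_image.2 ⟨Finset.univ.filter fun i => 0 ≤ ∑ j, w j * h j (z i).1, ?_, ?_⟩
      · refine mem_traces.2 ⟨_, ⟨w, rfl⟩, fun i => ?_⟩
        have e : ∀ j, (if h j (z i).1 = 1 then (1 : ℝ) else -1) = h j (z i).1 := by
          intro j
          rcases hbin (h j) (hh j) (z i).1 with e | e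
          · rw [if_pos e, e]
          · rw [e]; norm_num
        simp [e]
      · ext i
        have := hA i
        rw [Set.mem_ofPred_eq, zeroOne_eq_one_iff] at this
        simp [hφ, this]
  have h1 := Finset.card_biUnion_le_card_mul (Fintype.piFinset fun _ : Fin T => 𝒜)
    (fun s => (𝓑 s).image φ) ((Fintype.card ι + 1) ^ T)
    fun s _ => Finset.card_image_le.trans (card_traces_halfspace_le _)
  rw [Fintype.card_piFinset_const] at h1
  calc (traces (errorSets H T) z).card ≤ _ := Finset.card_le_card hsub
    _ ≤ 𝒜.card ^ T * (Fintype.card ι + 1) ^ T := h1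
    _ ≤ ((Fintype.card ι + 1) ^ V) ^ T * (Fintype.card ι + 1) ^ T :=
        Nat.mul_le_mul_right _ (Nat.pow_le_pow_left (card_traces_class_le hV _) T)
    _ = (Fintype.card ι + 1) ^ ((V + 1) * T) := by rw [← pow_mul, ← pow_add]; congr 1; ring

end Traces

/-! ### Symmetrization with a ghost sample four times as large -/

section Symmetrization

lemma exp_neg_le_quadratic {x : ℝ} (hx : 0 ≤ x) : Real.exp (-x) ≤ 1 - x + x ^ 2 / 2 := by
  rw [Real.exp_neg, ← one_div, div_le_iff₀ (Real.exp_pos x)]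
  have h := Real.quadratic_le_exp_of_nonneg hx
  have h1 : 0 < 1 - x + x ^ 2 / 2 := by nlinarith [sq_nonneg (x - 1)]
  have h2 := mul_le_mul_of_nonneg_left h h1.le
  nlinarith [sq_nonneg (x ^ 2)]

/-- The number of points of a finite family that lie in `A`. -/
noncomputable def hits {Z ι : Type*} [Fintype ι] (A : Set Z) (z : ι → Z) : ℝ :=
  ∑ i, A.indicator (fun _ => (1 : ℝ)) (z i)

variable {Z : Type*} [MeasurableSpace Z] {μ : Measure Z} [IsProbabilityMeasure μ]

lemma measurable_hits {ι : Type*} [Fintype ι] {A : Set Z} (hA : MeasurableSet A) :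
    Measurable fun z : ι → Z => hits A z :=
  Finset.measurable_sum _ fun i _ =>
    (measurable_const.indicator hA).comp (measurable_pi_apply i)

lemma integral_exp_neg_indicator {A : Set Z} (hA : MeasurableSet A) (c : ℝ) :
    ∫ z, Real.exp (-(c * A.indicator (fun _ => (1 : ℝ)) z)) ∂μ =
      1 - μ.real A * (1 - Real.exp (-c)) := by
  have e : (fun z => Real.exp (-(c * A.indicator (fun _ => (1 : ℝ)) z))) =
      fun z => 1 - (1 - Real.exp (-c)) * A.indicator (fun _ => (1 : ℝ)) z := by
    funext z
    by_cases h : z ∈ A <;> simp [h]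
  have hi : Integrable (A.indicator fun _ => (1 : ℝ)) μ := (integrable_const _).indicator hA
  rw [e, integral_sub (integrable_const _) (hi.const_mul _), integral_const_mul,
    integral_indicator_const _ hA]
  simp [mul_comm]

/-- Half of the time, a set of large measure is hit nearly as often as expected. -/
lemma half_le_measure_hits {ι : Type*} [Fintype ι] {A : Set Z} (hA : MeasurableSet A)
    {B B' : ℝ} (hB' : 0 ≤ B') (hBB' : B' < B) (hn : 2 * B ≤ Fintype.card ι * (B - B') ^ 2)
    (hR : B < μ.real A) :
    1 / 2 ≤ Measure.pi (fun _ : ι => μ) {z | Fintype.card ι * B' ≤ hits A z} := by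
  set R := μ.real A with hRdef
  set n : ℝ := ((Fintype.card ι : ℕ) : ℝ) with hndef
  have hn0 : 0 ≤ n := Nat.cast_nonneg _
  have hB0 : 0 < B := hB'.trans_lt hBB'
  have hR0 : 0 < R := hB0.trans hR
  -- the parameter that optimizes the Chernoff bound below
  set c := (R - B') / R with hc
  have hc0 : 0 ≤ c := div_nonneg (by linarith) hR0.le
  have hexp : 1 ≤ n * (R * (c - c ^ 2 / 2) - c * B') := by
    have e : R * (c - c ^ 2 / 2) - c * B' = (R - B') ^ 2 / (2 * R) := by
      rw [hc]; field_simp; ring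
    rw [e, ← mul_div_assoc, le_div_iff₀ (by positivity)]
    have h1 : (B - B') ^ 2 * R ≤ (R - B') ^ 2 * B := by
      have : B' * B' ≤ R * B := mul_le_mul (by linarith) hBB'.le hB' hR0.le
      nlinarith [mul_nonneg (sub_nonneg.2 hR.le) (sub_nonneg.2 this)]
    have h2 := mul_le_mul_of_nonneg_left h1 hn0
    have h3 := mul_le_mul_of_nonneg_right hn hR0.le
    nlinarith
  set F : (ι → Z) → ℝ := fun z => ∏ i, Real.exp (-(c * A.indicator (fun _ => (1 : ℝ)) (z i)))
    with hF
  have hFeq : ∀ z, F z = Real.exp (-(c * hits A z)) := fun z => by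
    rw [hits, Finset.mul_sum, ← Finset.sum_neg_distrib, Real.exp_sum]
  have hhits0 : ∀ z : ι → Z, 0 ≤ hits A z := fun z =>
    Finset.sum_nonneg fun i _ => Set.indicator_nonneg (fun _ _ => zero_le_one) _
  have hFI : Integrable F (Measure.pi fun _ : ι => μ) := by
    refine Integrable.of_bound (Measurable.aestronglyMeasurable ?_) 1 (ae_of_all _ fun z => ?_)
    · rw [funext hFeq]
      exact Real.measurable_exp.comp ((measurable_hits hA).const_mul c).neg
    · rw [hFeq, Real.norm_eq_abs, abs_of_pos (Real.exp_pos _), Real.exp_le_one_iff]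
      exact neg_nonpos.2 (mul_nonneg hc0 (hhits0 z))
  have hFint : ∫ z, F z ∂(Measure.pi fun _ : ι => μ) ≤
      Real.exp (-(n * (R * (c - c ^ 2 / 2)))) := by
    rw [hF, integral_fintype_prod_eq_prod
      (fun _ z => Real.exp (-(c * A.indicator (fun _ => (1 : ℝ)) z))), Finset.prod_const,
      Finset.card_univ, integral_exp_neg_indicator hA, ← mul_neg, Real.exp_nat_mul]
    have h1 := exp_neg_le_quadratic hc0
    have h2 : R * (c - c ^ 2 / 2) ≤ R * (1 - Real.exp (-c)) :=
      mul_le_mul_of_nonneg_left (by linarith) hR0.le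
    refine pow_le_pow_left₀ ?_ ?_ _
    · have h3 : R ≤ 1 := measureReal_le_one
      have h4 : Real.exp (-c) ≤ 1 := Real.exp_le_one_iff.2 (by linarith)
      have h5 := Real.exp_pos (-c)
      nlinarith
    · have := Real.add_one_le_exp (-(R * (c - c ^ 2 / 2)))
      linarith
  have hmarkov := mul_meas_ge_le_integral_of_nonneg
    (ae_of_all _ fun z => (hFeq z).symm ▸ (Real.exp_pos _).le) hFI (Real.exp (-(c * (n * B'))))
  have hreal : (Measure.pi fun _ : ι => μ).real {z | Real.exp (-(c * (n * B'))) ≤ F z} ≤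
      1 / 2 := by
    have h1 := hmarkov.trans hFint
    have e : Real.exp (-(n * (R * (c - c ^ 2 / 2)))) = Real.exp (-(c * (n * B'))) *
        Real.exp (-(n * (R * (c - c ^ 2 / 2) - c * B'))) := by
      rw [← Real.exp_add]; congr 1; ring
    rw [e] at h1
    have h2 := le_of_mul_le_mul_left h1 (Real.exp_pos _)
    have h3 : Real.exp (-(n * (R * (c - c ^ 2 / 2) - c * B'))) ≤ Real.exp (-1) :=
      Real.exp_le_exp.2 (by linarith)
    have h4 : Real.exp (-1) ≤ 1 / 2 := by
      have := Real.exp_one_gt_d9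
      rw [Real.exp_neg, ← one_div]
      exact one_div_le_one_div_of_le (by norm_num) (by linarith)
    linarith
  have hmeas : MeasurableSet {z : ι → Z | n * B' ≤ hits A z} :=
    measurableSet_le measurable_const (measurable_hits hA)
  have hcompl : (Measure.pi fun _ : ι => μ).real {z : ι → Z | n * B' ≤ hits A z}ᶜ ≤ 1 / 2 := by
    refine (measureReal_mono fun z hz => ?_).trans hreal
    simp only [Set.mem_compl_iff, Set.mem_ofPred_eq, not_le] at hz ⊢
    rw [hFeq, Real.exp_le_exp]
    exact neg_le_neg (mul_le_mul_of_nonneg_left hz.le hc0)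
  rw [probReal_compl_eq_one_sub hmeas] at hcompl
  rw [← ofReal_measureReal (measure_ne_top _ _),
    show (1 / 2 : ENNReal) = ENNReal.ofReal (1 / 2) by
      rw [ENNReal.ofReal_div_of_pos two_pos]; simp]
  exact ENNReal.ofReal_le_ofReal (by linarith)

/-- The position in the joint sample of the real point (`none`) or of a ghost point of a block. -/
def position {m : ℕ} (i : Fin m) : Option (Fin 4) → Fin m ⊕ (Fin m × Fin 4)
  | none => Sum.inl i
  | some k => Sum.inr (i, k)

/-- The joint sample consists of `m` blocks of one real and four ghost points. -/
def blockEquiv (m : ℕ) : Fin m × Option (Fin 4) ≃ Fin m ⊕ (Fin m × Fin 4) where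
  toFun p := position p.1 p.2
  invFun
    | Sum.inl i => (i, none)
    | Sum.inr (i, k) => (i, some k)
  left_inv := by rintro ⟨i, _ | k⟩ <;> rfl
  right_inv := by rintro (i | ⟨i, k⟩) <;> rfl

/-- The permutation of the joint sample that in each block exchanges the real point with the
point chosen by `J`. -/
def blockSwap {m : ℕ} (J : Fin m → Option (Fin 4)) : Equiv.Perm (Fin m ⊕ (Fin m × Fin 4)) :=
  (blockEquiv m).symm.trans
    ((Equiv.prodShear (Equiv.refl _) fun i => Equiv.swap none (J i)).trans (blockEquiv m))

lemma blockSwap_inl {m : ℕ} (J : Fin m → Option (Fin 4)) (i : Fin m) :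
    blockSwap J (Sum.inl i) = position i (J i) := by
  change position i (Equiv.swap none (J i) none) = _
  rw [Equiv.swap_apply_left]

/-- A random choice of one point per block rarely picks few members of a set `t` of which many
are left over. -/
lemma card_choices_le {m : ℕ} (t : Finset (Fin m ⊕ (Fin m × Fin 4))) {ε B' η : ℝ} (hη : 0 ≤ η) :
    ((Finset.univ.filter fun J : Fin m → Option (Fin 4) =>
      ((Finset.univ.filter fun i => position i (J i) ∈ t).card : ℝ) ≤ ε * m ∧
      4 * m * B' ≤ t.card - (Finset.univ.filter fun i => position i (J i) ∈ t).card).card : ℝ) ≤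
    5 ^ m * Real.exp (-(m * ((ε + 4 * B') / 5 * (1 - Real.exp (-η)) - η * ε))) := by
  classical
  set c : Fin m → Option (Fin 4) → ℝ := fun i o => if position i o ∈ t then 1 else 0 with hc
  have hcard : ∀ J : Fin m → Option (Fin 4),
      ((Finset.univ.filter fun i => position i (J i) ∈ t).card : ℝ) = ∑ i, c i (J i) := fun J => by
    simp [hc]
  have htot : (t.card : ℝ) = ∑ i, ∑ o, c i o := by
    rw [← Finset.sum_product', Finset.univ_product_univ,
      Fintype.sum_equiv (blockEquiv m) (fun p => c p.1 p.2) (fun p => if p ∈ t then (1 : ℝ) else 0) fun p => rfl]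
    simp
  -- the weight `ν` is chosen so that the number of elements of `t` cancels
  set ν := (1 - Real.exp (-η)) / 5 with hν
  have hexp1 : Real.exp (-η) ≤ 1 := Real.exp_le_one_iff.2 (by linarith)
  have hν0 : 0 ≤ ν := div_nonneg (by linarith) (by norm_num)
  have hνη : ν ≤ η := by
    have := Real.add_one_le_exp (-η)
    rw [hν, div_le_iff₀ (by norm_num)]; linarith
  have hblock : ∀ i, ∑ o, Real.exp (-(η * c i o)) ≤ 5 * Real.exp (-(ν * ∑ o, c i o)) := by
    intro i
    have e : ∀ o, Real.exp (-(η * c i o)) = 1 - (1 - Real.exp (-η)) * c i o := by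
      intro o
      by_cases h : position i o ∈ t <;> simp [hc, h]
    have h1 : ∑ o, Real.exp (-(η * c i o)) = 5 * (1 - ν * ∑ o, c i o) := by
      rw [Finset.sum_congr rfl fun o _ => e o, Finset.sum_sub_distrib, ← Finset.mul_sum, hν]
      simp; ring
    have h2 := Real.add_one_le_exp (-(ν * ∑ o, c i o))
    rw [h1]; linarith
  have hprod : ∑ J : Fin m → Option (Fin 4), Real.exp (-(η * ∑ i, c i (J i))) ≤
      5 ^ m * Real.exp (-(ν * t.card)) := by
    calc ∑ J : Fin m → Option (Fin 4), Real.exp (-(η * ∑ i, c i (J i)))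
        = ∑ J : Fin m → Option (Fin 4), ∏ i, Real.exp (-(η * c i (J i))) := by
          refine Finset.sum_congr rfl fun J _ => ?_
          rw [← Real.exp_sum, Finset.mul_sum, Finset.sum_neg_distrib]
      _ = ∏ i : Fin m, ∑ o, Real.exp (-(η * c i o)) := by
          rw [Finset.prod_univ_sum]; simp
      _ ≤ ∏ i : Fin m, 5 * Real.exp (-(ν * ∑ o, c i o)) :=
          Finset.prod_le_prod (fun i _ => Finset.sum_nonneg fun o _ => (Real.exp_pos _).le)
            fun i _ => hblock i
      _ = 5 ^ m * Real.exp (-(ν * t.card)) := by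
          rw [Finset.prod_mul_distrib, ← Real.exp_sum, htot, Finset.mul_sum,
            Finset.sum_neg_distrib]
          simp
  calc _ = ∑ J ∈ Finset.univ.filter fun J : Fin m → Option (Fin 4) =>
        ((Finset.univ.filter fun i => position i (J i) ∈ t).card : ℝ) ≤ ε * m ∧
        4 * m * B' ≤ t.card - (Finset.univ.filter fun i => position i (J i) ∈ t).card,
        (1 : ℝ) := by simp
    _ ≤ ∑ J ∈ Finset.univ.filter fun J : Fin m → Option (Fin 4) =>
        ((Finset.univ.filter fun i => position i (J i) ∈ t).card : ℝ) ≤ ε * m ∧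
        4 * m * B' ≤ t.card - (Finset.univ.filter fun i => position i (J i) ∈ t).card,
        Real.exp ((η - ν) * (ε * m) + ν * (t.card - 4 * m * B')) *
          Real.exp (-(η * ∑ i, c i (J i))) := by
        refine Finset.sum_le_sum fun J hJ => ?_
        obtain ⟨h1, h2⟩ := (Finset.mem_filter.1 hJ).2
        rw [hcard] at h1 h2
        rw [← Real.exp_add, Real.one_le_exp_iff]
        have h3 := mul_le_mul_of_nonneg_left h1 (sub_nonneg.2 hνη)
        have h4 := mul_le_mul_of_nonneg_left h2 hν0
        linarith
    _ ≤ ∑ J : Fin m → Option (Fin 4),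
        Real.exp ((η - ν) * (ε * m) + ν * (t.card - 4 * m * B')) *
          Real.exp (-(η * ∑ i, c i (J i))) :=
        Finset.sum_le_sum_of_subset_of_nonneg (Finset.filter_subset _ _)
          fun J _ _ => by positivity
    _ ≤ Real.exp ((η - ν) * (ε * m) + ν * (t.card - 4 * m * B')) *
          (5 ^ m * Real.exp (-(ν * t.card))) := by
        rw [← Finset.mul_sum]
        exact mul_le_mul_of_nonneg_left hprod (Real.exp_pos _).le
    _ = _ := by
        rw [mul_left_comm, ← Real.exp_add]
        congr 2
        rw [hν]; ring

lemma measurePreserving_comp_perm {ι : Type*} [Fintype ι] (σ : Equiv.Perm ι) :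
    MeasurePreserving (fun z : ι → Z => z ∘ σ) (Measure.pi fun _ => μ) (Measure.pi fun _ => μ) := by
  have h := measurePreserving_piCongrLeft (fun _ : ι => μ) σ.symm
  have e : (fun z : ι → Z => z ∘ σ) = MeasurableEquiv.piCongrLeft (fun _ : ι => Z) σ.symm := by
    funext z i
    have := MeasurableEquiv.piCongrLeft_apply_apply σ.symm (β := fun _ => Z) z (σ i)
    rw [Equiv.symm_apply_apply] at this
    exact this.symm
  rw [e]; exact h

/-- Uniform deviation bound: with high probability, no member of a countable family with few
traces has empirical frequency at most `ε` and probability above `B`. -/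
lemma measure_exists_deviation_le {F : Set (Set Z)} (hF : F.Countable)
    (hFm : ∀ A ∈ F, MeasurableSet A) {m N : ℕ}
    (hN : ∀ z : Fin m ⊕ (Fin m × Fin 4) → Z, (traces F z).card ≤ N)
    {ε B B' η : ℝ} (hη : 0 ≤ η) (hB' : 0 ≤ B') (hBB' : B' < B)
    (hm : 2 * B ≤ 4 * m * (B - B') ^ 2) :
    Measure.pi (fun _ : Fin m => μ) {S | ∃ A ∈ F, hits A S ≤ ε * m ∧ B < μ.real A} ≤
      ENNReal.ofReal (2 * (N *
        Real.exp (-(m * ((ε + 4 * B') / 5 * (1 - Real.exp (-η)) - η * ε))))) := by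
  classical
  set P : ℝ := Real.exp (-(m * ((ε + 4 * B') / 5 * (1 - Real.exp (-η)) - η * ε))) with hP
  set ν := Measure.pi fun _ : Fin m ⊕ (Fin m × Fin 4) => μ with hν
  set W' : Set ((Fin m → Z) × (Fin m × Fin 4 → Z)) :=
    {p | ∃ A ∈ F, hits A p.1 ≤ ε * m ∧ 4 * m * B' ≤ hits A p.2} with hW'
  set e := MeasurableEquiv.sumPiEquivProdPi fun _ : Fin m ⊕ (Fin m × Fin 4) => Z with he
  have hW'm : MeasurableSet W' := by
    have : W' = ⋃ A ∈ F, {p : (Fin m → Z) × (Fin m × Fin 4 → Z) |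
        hits A p.1 ≤ ε * m ∧ 4 * m * B' ≤ hits A p.2} := by
      ext p
      simp only [hW', Set.mem_ofPred_eq, Set.mem_iUnion, exists_prop]
    rw [this]
    refine MeasurableSet.biUnion hF fun A hA => ?_
    exact (measurableSet_le ((measurable_hits (hFm A hA)).comp measurable_fst)
      measurable_const).inter (measurableSet_le measurable_const
        ((measurable_hits (hFm A hA)).comp measurable_snd))
  have hemp : MeasurePreserving e ν
      ((Measure.pi fun _ : Fin m => μ).prod (Measure.pi fun _ : Fin m × Fin 4 => μ)) :=
    measurePreserving_sumPiEquivProdPi fun _ : Fin m ⊕ (Fin m × Fin 4) => μ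
  have hWm : MeasurableSet (e ⁻¹' W') := e.measurable hW'm
  -- the ghost sample confirms each deviation with probability at least `1 / 2`
  have hghost : Measure.pi (fun _ : Fin m => μ) {S | ∃ A ∈ F, hits A S ≤ ε * m ∧ B < μ.real A} ≤
      2 * ν (e ⁻¹' W') := by
    rw [hemp.measure_preimage hW'm.nullMeasurableSet, Measure.prod_apply hW'm]
    have h1 := mul_meas_ge_le_lintegral (μ := Measure.pi fun _ : Fin m => μ)
      (measurable_measure_prodMk_left (ν := Measure.pi fun _ : Fin m × Fin 4 => μ) hW'm) (1 / 2)
    have h2 : Measure.pi (fun _ : Fin m => μ) {S | ∃ A ∈ F, hits A S ≤ ε * m ∧ B < μ.real A} ≤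
        Measure.pi (fun _ : Fin m => μ) {S | (1 / 2 : ENNReal) ≤
          Measure.pi (fun _ : Fin m × Fin 4 => μ) (Prod.mk S ⁻¹' W')} := by
      refine measure_mono ?_
      rintro S ⟨A, hA, hS, hR⟩
      have hcard : (Fintype.card (Fin m × Fin 4) : ℝ) = 4 * m := by
        simp; ring
      have h3 := half_le_measure_hits (ι := Fin m × Fin 4) (hFm A hA) hB' hBB'
        (by rw [hcard]; exact hm) hR
      rw [hcard] at h3
      exact h3.trans (measure_mono fun G hG => ⟨A, hA, hS, hG⟩)
    calc _ ≤ 2 * (1 / 2 * Measure.pi (fun _ : Fin m => μ) {S | (1 / 2 : ENNReal) ≤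
          Measure.pi (fun _ : Fin m × Fin 4 => μ) (Prod.mk S ⁻¹' W')}) := by
          have e2 : (2 : ENNReal) * (1 / 2) = 1 := by
            rw [one_div, ENNReal.mul_inv_cancel two_ne_zero ENNReal.ofNat_ne_top]
          rw [← mul_assoc, e2, one_mul]
          exact h2
      _ ≤ _ := by gcongr
  -- for a fixed joint sample, few of the swaps produce a deviation
  have hswap : ∀ z : Fin m ⊕ (Fin m × Fin 4) → Z,
      ((Finset.univ.filter fun J : Fin m → Option (Fin 4) => z ∘ blockSwap J ∈ e ⁻¹' W').card : ℝ)
        ≤ N * (5 ^ m * P) := by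
    intro z
    set good : Finset (Fin m ⊕ (Fin m × Fin 4)) → Finset (Fin m → Option (Fin 4)) := fun t =>
      Finset.univ.filter fun J : Fin m → Option (Fin 4) =>
        ((Finset.univ.filter fun i => position i (J i) ∈ t).card : ℝ) ≤ ε * m ∧
        4 * m * B' ≤ t.card - (Finset.univ.filter fun i => position i (J i) ∈ t).card with hgood
    have hsub : (Finset.univ.filter fun J : Fin m → Option (Fin 4) =>
        z ∘ blockSwap J ∈ e ⁻¹' W') ⊆ (traces F z).biUnion good := by
      intro J hJ
      obtain ⟨A, hA, h1, h2⟩ := (Finset.mem_filter.1 hJ).2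
      set t := Finset.univ.filter fun i => z i ∈ A with ht
      have hreal : hits A (e (z ∘ blockSwap J)).1 =
          (Finset.univ.filter fun i => position i (J i) ∈ t).card := by
        have : ∀ i, (e (z ∘ blockSwap J)).1 i = z (position i (J i)) := fun i => by
          rw [← blockSwap_inl]; rfl
        simp only [hits, this]
        simp [ht, Set.indicator_apply]
      have htotal : hits A (e (z ∘ blockSwap J)).1 + hits A (e (z ∘ blockSwap J)).2 = t.card := by
        have h3 : hits A (e (z ∘ blockSwap J)).1 + hits A (e (z ∘ blockSwap J)).2 =
            ∑ i, A.indicator (fun _ => (1 : ℝ)) (z (blockSwap J i)) :=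
          (Fintype.sum_sum_type fun i => A.indicator (fun _ => (1 : ℝ)) (z (blockSwap J i))).symm
        rw [h3, Equiv.sum_comp (blockSwap J) fun i => A.indicator (fun _ => (1 : ℝ)) (z i)]
        simp [ht, Set.indicator_apply]
      refine Finset.mem_biUnion.2 ⟨t, mem_traces.2 ⟨A, hA, fun i => by simp [ht]⟩, ?_⟩
      refine Finset.mem_filter.2 ⟨Finset.mem_univ _, ?_, ?_⟩
      · rw [← hreal]; exact h1
      · rw [← hreal, ← htotal, add_sub_cancel_left]; exact h2
    calc _ ≤ (((traces F z).biUnion good).card : ℝ) := by exact_mod_cast Finset.card_le_card hsub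
      _ ≤ ∑ t ∈ traces F z, ((good t).card : ℝ) := by exact_mod_cast Finset.card_biUnion_le
      _ ≤ ∑ _t ∈ traces F z, 5 ^ m * P := Finset.sum_le_sum fun t _ => card_choices_le t hη
      _ = (traces F z).card * (5 ^ m * P) := by rw [Finset.sum_const, nsmul_eq_mul]
      _ ≤ N * (5 ^ m * P) := by
          have : ((traces F z).card : ℝ) ≤ N := by exact_mod_cast hN z
          have : 0 ≤ 5 ^ m * P := by positivity
          gcongr
  -- averaging over the swaps, which preserve the law of the joint sample
  have havg : (5 : ENNReal) ^ m * ν (e ⁻¹' W') ≤ ENNReal.ofReal (N * (5 ^ m * P)) := by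
    calc (5 : ENNReal) ^ m * ν (e ⁻¹' W')
        = ∑ J : Fin m → Option (Fin 4), ν ((fun z => z ∘ blockSwap J) ⁻¹' (e ⁻¹' W')) := by
          rw [Finset.sum_congr rfl fun J _ => (measurePreserving_comp_perm
            (μ := μ) (blockSwap J)).measure_preimage hWm.nullMeasurableSet]
          simp [hν]
      _ = ∑ J : Fin m → Option (Fin 4),
            ∫⁻ z, ((fun z => z ∘ blockSwap J) ⁻¹' (e ⁻¹' W')).indicator 1 z ∂ν := by
          refine Finset.sum_congr rfl fun J _ => (lintegral_indicator_one ?_).symm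
          exact (measurePreserving_comp_perm (μ := μ) (blockSwap J)).measurable hWm
      _ = ∫⁻ z, ∑ J : Fin m → Option (Fin 4),
            ((fun z => z ∘ blockSwap J) ⁻¹' (e ⁻¹' W')).indicator 1 z ∂ν := by
          refine (lintegral_finsetSum _ fun J _ => measurable_one.indicator ?_).symm
          exact (measurePreserving_comp_perm (μ := μ) (blockSwap J)).measurable hWm
      _ ≤ ∫⁻ _z, ENNReal.ofReal (N * (5 ^ m * P)) ∂ν := by
          refine lintegral_mono fun z => ?_
          refine le_trans (le_of_eq ?_) (ENNReal.ofReal_le_ofReal (hswap z))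
          rw [ENNReal.ofReal_natCast]
          simp [Set.indicator_apply]
      _ = ENNReal.ofReal (N * (5 ^ m * P)) := by simp [hν]
  have h5 : (5 : ENNReal) ^ m = ENNReal.ofReal (5 ^ m) := by
    rw [ENNReal.ofReal_pow (by norm_num)]; simp
  have e5 : (N : ℝ) * (5 ^ m * P) = 5 ^ m * (N * P) := by ring
  rw [h5, e5, ENNReal.ofReal_mul (by positivity),
    ENNReal.mul_le_mul_iff_right (by positivity) ENNReal.ofReal_ne_top] at havg
  calc _ ≤ 2 * ν (e ⁻¹' W') := hghost
    _ ≤ 2 * ENNReal.ofReal (N * P) := by gcongr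
    _ = ENNReal.ofReal (2 * (N * P)) := by
        rw [ENNReal.ofReal_mul (by norm_num)]; simp

end Symmetrization

/-! ### Error sets of weighted votes -/

section Errors

variable {X : Type*} {H : Set (X → ℝ)}

lemma errorSets_mono {H₀ : Set (X → ℝ)} (hH : H₀ ⊆ H) (T : ℕ) :
    errorSets H₀ T ⊆ errorSets H T := by
  rintro _ ⟨h, w, hh, rfl⟩
  exact ⟨h, w, fun j => hH (hh j), rfl⟩

lemma traces_mono {Z ι : Type*} [Fintype ι] {F F' : Set (Set Z)} (h : F ⊆ F') (z : ι → Z) :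
    traces F z ⊆ traces F' z := by
  intro t ht
  obtain ⟨A, hA, e⟩ := mem_traces.1 ht
  exact mem_traces.2 ⟨A, h hA, e⟩

/-- The error set of a vote depends on the real coefficients only through the finite set of sign
patterns of the voters with a nonnegative vote, so there are countably many such sets. -/
lemma countable_errorSets (hbin : ∀ h ∈ H, ∀ x, h x = 1 ∨ h x = -1) (hc : H.Countable) (T : ℕ) :
    (errorSets H T).Countable := by
  classical
  have : Countable ↥H := hc.to_subtype
  refine (Set.countable_range fun p : (Fin T → ↥H) × Set (Fin T → Bool) =>
    {z : X × Bool | z.2 = false ↔ (fun j => decide ((p.1 j).1 z.1 = 1)) ∈ p.2}).mono ?_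
  rintro _ ⟨h, w, hh, rfl⟩
  refine ⟨⟨fun j => ⟨h j, hh j⟩, {b | 0 ≤ ∑ j, w j * if b j then 1 else -1}⟩, ?_⟩
  ext z
  have e : ∀ j, (if decide (h j z.1 = 1) = true then (1 : ℝ) else -1) = h j z.1 := by
    intro j
    rcases hbin (h j) (hh j) z.1 with e | e
    · simp [e]
    · rw [e]; norm_num
  simp only [Set.mem_ofPred_eq, zeroOne_eq_one_iff, e]

lemma measurableSet_errorSets [MeasurableSpace X] (hmeas : ∀ h ∈ H, Measurable h) {T : ℕ}
    {A : Set (X × Bool)} (hA : A ∈ errorSets H T) : MeasurableSet A := by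
  obtain ⟨h, w, hh, rfl⟩ := hA
  have hv : Measurable fun z : X × Bool => ∑ j, w j * h j z.1 :=
    Finset.measurable_sum _ fun j _ => ((hmeas _ (hh j)).comp measurable_fst).const_mul _
  have e : {z : X × Bool | zeroOne (∑ j, w j * h j z.1) z.2 = 1} =
      ({z | z.2 = false} ∩ {z | 0 ≤ ∑ j, w j * h j z.1}) ∪
      ({z | z.2 = false}ᶜ ∩ {z | 0 ≤ ∑ j, w j * h j z.1}ᶜ) := by
    ext z
    simp only [Set.mem_ofPred_eq, zeroOne_eq_one_iff, Set.mem_union, Set.mem_inter_iff,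
      Set.mem_compl_iff]
    tauto
  have h1 : MeasurableSet {z : X × Bool | z.2 = false} :=
    measurable_snd (measurableSet_singleton false)
  have h2 : MeasurableSet {z : X × Bool | 0 ≤ ∑ j, w j * h j z.1} :=
    measurableSet_le measurable_const hv
  rw [e]
  exact (h1.inter h2).union (h1.compl.inter h2.compl)

lemma zeroOne_eq_indicator (f : X → ℝ) (z : X × Bool) :
    zeroOne (f z.1) z.2 = {z : X × Bool | zeroOne (f z.1) z.2 = 1}.indicator (fun _ => 1) z := by
  by_cases h : zeroOne (f z.1) z.2 = 1
  · rw [Set.indicator_of_mem (by exact h), h]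
  · rw [Set.indicator_of_notMem (by exact h)]
    rw [zeroOne_eq_one_iff] at h
    cases hz : z.2 <;> simp_all [zeroOne]

/-- An output of the algorithm is a weighted vote of as many members of the class as there are
iterations. -/
lemma IsBoostOutput.exists_vote_eq (hbin : ∀ h ∈ H, ∀ x, h x = 1 ∨ h x = -1) {m : ℕ}
    {ℓ : ℝ → ℝ} {B₂ ρ a : ℝ} {S : Fin m → X × Bool} {w : Weighting H}
    (h : IsBoostOutput ℓ B₂ ρ a S w) :
    ∃ (g : Fin ⌈(m : ℝ) ^ a⌉₊ → X → ℝ) (c : Fin ⌈(m : ℝ) ^ a⌉₊ → ℝ), (∀ j, g j ∈ H) ∧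
      ∀ x, vote w x = ∑ j, c j * g j x := by
  obtain ⟨it, h0, hstep, i, hi, -, rfl⟩ := h
  set T := ⌈(m : ℝ) ^ a⌉₊
  have hex : ∀ j : Fin T, ∃ g ∈ H, ∃ c : ℝ, ∀ x,
      vote (it (j + 1)) x = vote (it j) x + c * g x := by
    intro j
    obtain ⟨h, v, α, -, hv, -, -, -, e⟩ := hstep j j.2
    rcases hv with rfl | rfl
    · exact ⟨h.1, h.2, α, fun x => by rw [e, vote_add hbin, vote_smul, vote_unitWeight]⟩
    · refine ⟨h.1, h.2, -α, fun x => ?_⟩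
      rw [e, vote_add hbin, smul_neg, ← neg_smul, vote_smul, vote_unitWeight]
  choose g hg c hc using hex
  have hit : ∀ n ≤ T, ∀ x, vote (it n) x =
      ∑ j : Fin T, (if (j : ℕ) < n then c j else 0) * g j x := by
    intro n
    induction n with
    | zero =>
      intro _ x
      have := vote_smul 0 (0 : Weighting H) x
      simpa [h0] using this
    | succ n ih =>
      intro hn x
      have h1 := hc ⟨n, hn⟩ x
      simp only at h1
      rw [h1, ih (by omega) x]
      have h2 : c ⟨n, hn⟩ * g ⟨n, hn⟩ x = ∑ j : Fin T, if j = ⟨n, hn⟩ then c j * g j x else 0 := by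
        simp
      rw [h2, ← Finset.sum_add_distrib]
      refine Finset.sum_congr rfl fun j _ => ?_
      rcases lt_trichotomy (j : ℕ) n with hj | hj | hj
      · have : j ≠ ⟨n, hn⟩ := fun e => by simp [e] at hj
        simp [hj, this, Nat.lt_succ_of_lt hj]
      · have : j = ⟨n, hn⟩ := Fin.ext hj
        simp [this]
      · have h3 : j ≠ ⟨n, hn⟩ := fun e => by simp [e] at hj
        have h4 : ¬ (j : ℕ) < n := by omega
        have h5 : ¬ (j : ℕ) < n + 1 := by omega
        simp [h3, h4, h5]
  exact ⟨g, _, hg, hit i (Finset.mem_Icc.1 hi).2⟩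

/-- A deviation for a weighted vote of members of `H` is already one for members of a countable
subclass that approximates `H` pointwise, since binary functions converge by being eventually
equal at each point. -/
lemma exists_errorSet_of_vote [MeasurableSpace X] {μ : Measure (X × Bool)}
    [IsProbabilityMeasure μ] (hbin : ∀ h ∈ H, ∀ x, h x = 1 ∨ h x = -1)
    (hmeas : ∀ h ∈ H, Measurable h) {H₀ : Set (X → ℝ)} (hH₀ : H₀ ⊆ H)
    (happrox : ∀ h ∈ H, ∃ u : ℕ → X → ℝ, (∀ n, u n ∈ H₀) ∧
      ∀ x, Filter.Tendsto (fun n => u n x) Filter.atTop (nhds (h x)))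
    {m T : ℕ} (hm : 0 < m) {S : Fin m → X × Bool} {w : Weighting H} {g : Fin T → X → ℝ}
    {c : Fin T → ℝ} (hg : ∀ j, g j ∈ H) (hw : ∀ x, vote w x = ∑ j, c j * g j x) {ε B : ℝ}
    (hemp : empRisk S w ≤ ε) (hrisk : B < risk μ w) :
    ∃ A ∈ errorSets H₀ T, hits A S ≤ ε * m ∧ B < μ.real A := by
  have hm' : (0 : ℝ) < m := by exact_mod_cast hm
  choose u hu hlim using fun j => happrox (g j) (hg j)
  set A : Set (X × Bool) := {z | zeroOne (∑ j, c j * g j z.1) z.2 = 1} with hA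
  set A' : ℕ → Set (X × Bool) := fun n => {z | zeroOne (∑ j, c j * u j n z.1) z.2 = 1} with hA'
  have hA'mem : ∀ n, A' n ∈ errorSets H₀ T := fun n => ⟨fun j => u j n, c, fun j => hu j n, rfl⟩
  have hAm : MeasurableSet A := measurableSet_errorSets hmeas ⟨g, c, hg, rfl⟩
  have hA'm : ∀ n, MeasurableSet (A' n) := fun n =>
    measurableSet_errorSets (fun h hh => hmeas h (hH₀ hh)) (hA'mem n)
  have hevu : ∀ j x, ∀ᶠ n in Filter.atTop, u j n x = g j x := by
    intro j x
    have h1 : ∀ᶠ n in Filter.atTop, u j n x ∈ Metric.ball (g j x) 1 :=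
      hlim j x (Metric.ball_mem_nhds _ one_pos)
    filter_upwards [h1] with n hn
    rw [Metric.mem_ball, Real.dist_eq] at hn
    rcases hbin _ (hH₀ (hu j n)) x with e | e <;> rcases hbin _ (hg j) x with e' | e' <;>
      rw [e, e'] at hn ⊢ <;> norm_num at hn
  have hev : ∀ z, ∀ᶠ n in Filter.atTop, z ∈ A' n ↔ z ∈ A := by
    intro z
    filter_upwards [Filter.eventually_all.2 fun j => hevu j z.1] with n hn
    simp only [hA, hA', Set.mem_ofPred_eq, hn]
  have hrisk' : risk μ w = μ.real A := by
    rw [risk, ← integral_indicator_one hAm]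
    congr 1; funext z
    rw [hw]
    exact zeroOne_eq_indicator (fun x => ∑ j, c j * g j x) z
  have hemp' : hits A S ≤ ε * m := by
    have e : empRisk S w = 1 / m * hits A S := by
      rw [empRisk, hits]
      congr 1
      refine Finset.sum_congr rfl fun i _ => ?_
      rw [hw]
      exact zeroOne_eq_indicator (fun x => ∑ j, c j * g j x) (S i)
    rw [e, one_div, inv_mul_le_iff₀ hm'] at hemp
    linarith
  have ht : Filter.Tendsto (fun n => μ.real (A' n)) Filter.atTop (nhds (μ.real A)) :=
    (ENNReal.tendsto_toReal (measure_ne_top μ A)).comp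
      (tendsto_measure_of_tendsto_indicator_of_isFiniteMeasure Filter.atTop μ hA'm hev)
  have hev1 : ∀ᶠ n in Filter.atTop, B < μ.real (A' n) :=
    ht.eventually_const_lt (by rw [← hrisk']; exact hrisk)
  obtain ⟨n, hn1, hn2⟩ :=
    (hev1.and (Filter.eventually_all.2 fun i : Fin m => hev (S i))).exists
  refine ⟨A' n, hA'mem n, ?_, hn1⟩
  have : hits (A' n) S = hits A S := by
    refine Finset.sum_congr rfl fun i _ => ?_
    by_cases h : S i ∈ A
    · rw [Set.indicator_of_mem h, Set.indicator_of_mem ((hn2 i).2 h)]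
    · rw [Set.indicator_of_notMem h, Set.indicator_of_notMem (fun h' => h ((hn2 i).1 h'))]
  rw [this]; exact hemp'

end Errors

/-! ### Numerical estimates -/

/-- The exponent of the uniform deviation bound.  A ghost sample of size `4 * m` makes it exceed
`m * D` by a constant factor, which later absorbs the rounding of the number of iterations. -/
lemma exists_deviation_exponent {m ε D : ℝ} (hm : 0 < m) (hε : 0 < ε) (hmD : 50 ≤ m * D) :
    ∃ B' η : ℝ, 0 ≤ η ∧ 0 ≤ B' ∧ B' < ε + 2 * √(ε * D) + 4 * D ∧
      2 * (ε + 2 * √(ε * D) + 4 * D) ≤ 4 * m * (ε + 2 * √(ε * D) + 4 * D - B') ^ 2 ∧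
      1.15 * (m * D) ≤ m * ((ε + 4 * B') / 5 * (1 - Real.exp (-η)) - η * ε) := by
  have hD : 0 < D := by
    by_contra h
    have := mul_nonpos_of_nonneg_of_nonpos hm.le (not_lt.1 h)
    linarith
  rw [Real.sqrt_mul hε.le]
  have he2 := Real.sq_sqrt hε.le
  have hs2 := Real.sq_sqrt hD.le
  have he0 := Real.sqrt_pos.2 hε
  have hs0 := Real.sqrt_pos.2 hD
  set e := √ε
  set s := √D
  set B := ε + 2 * (e * s) + 4 * D with hB
  have hB0 : 0 < B := by positivity
  have hBε : B - ε = 2 * s * (e + 2 * s) := by rw [hB, ← hs2]; ring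
  have hBle : B ≤ (e + 2 * s) ^ 2 := by
    rw [hB, ← he2, ← hs2]
    nlinarith [mul_pos he0 hs0]
  set y := √(B / (2 * m)) with hy
  have hy2 : y ^ 2 = B / (2 * m) := Real.sq_sqrt (by positivity)
  have hy0 : 0 < y := Real.sqrt_pos.2 (by positivity)
  have hyle : y ≤ 0.05 * (B - ε) := by
    refine Real.sqrt_le_iff.2 ⟨by rw [hBε]; positivity, ?_⟩
    rw [div_le_iff₀ (by positivity), hBε]
    have h1 : 50 * (e + 2 * s) ^ 2 ≤ m * s ^ 2 * (e + 2 * s) ^ 2 := by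
      rw [hs2]
      exact mul_le_mul_of_nonneg_right hmD (sq_nonneg _)
    nlinarith
  have hBε0 : 0 < B - ε := by rw [hBε]; positivity
  set p := (ε + 4 * (B - y)) / 5 with hp
  have hpε : 0.76 * (B - ε) ≤ p - ε := by rw [hp]; linarith
  have hp0 : 0 < p := by linarith
  have hpB : p ≤ (e + 2 * s) ^ 2 := by rw [hp]; linarith
  have hη : 0 ≤ (p - ε) / p := div_nonneg (by linarith) hp0.le
  refine ⟨B - y, (p - ε) / p, hη, by linarith, by linarith, ?_, ?_⟩
  · rw [sub_sub_cancel, hy2]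
    refine le_of_eq ?_
    field_simp; norm_num
  · have h1 := exp_neg_le_quadratic hη
    have h2 : (p - ε) ^ 2 / (2 * p) ≤
        p * (1 - Real.exp (-((p - ε) / p))) - (p - ε) / p * ε := by
      have h3 := mul_le_mul_of_nonneg_left h1 hp0.le
      have h4 : p * (1 - (p - ε) / p + ((p - ε) / p) ^ 2 / 2) =
          p - (p - ε) / p * ε - (p - ε) ^ 2 / (2 * p) := by field_simp; ring
      linarith
    have h5 : 1.15 * D ≤ (p - ε) ^ 2 / (2 * p) := by
      rw [le_div_iff₀ (by positivity)]
      have h6 : (0.76 * (B - ε)) ^ 2 ≤ (p - ε) ^ 2 :=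
        pow_le_pow_left₀ (by linarith) hpε 2
      have h7 := mul_le_mul_of_nonneg_left hpB hD.le
      rw [hBε] at h6
      have h8 : (0.76 * (2 * s * (e + 2 * s))) ^ 2 = 2.3104 * (D * (e + 2 * s) ^ 2) := by
        rw [← hs2]; ring
      have h9 : 0 ≤ D * (e + 2 * s) ^ 2 := by positivity
      linarith
    have h10 := mul_le_mul_of_nonneg_left (h5.trans h2) hm.le
    rw [← hp]
    linarith

/-! ### The deviation bound for outputs -/

section Deviation

variable {X : Type*} [MeasurableSpace X] {H : Set (X → ℝ)} {μ : Measure (X × Bool)}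
  [IsProbabilityMeasure μ]

/-- With high probability no weighted vote of `T` members of a countable class has empirical risk
at most `ε` and risk above the bound. -/
lemma measure_errorSets_deviation_le (hbin : ∀ h ∈ H, ∀ x, h x = 1 ∨ h x = -1)
    (hmeas : ∀ h ∈ H, Measurable h) {V : ℕ} (hV : vcDim H = V) {H₀ : Set (X → ℝ)}
    (hH₀ : H₀ ⊆ H) (hcount : H₀.Countable) {m T : ℕ} (hm : 3 ≤ m) {ε D L q : ℝ} (hε : 0 < ε)
    (hq : 12 ≤ q) (hT : (T : ℝ) ≤ q + 1) (hL : 0 ≤ L) (hmD : 50 ≤ m * D)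
    (hD : m * D = q * ((V + 1) * Real.log (2 * Real.exp 1 * m) + L)) :
    Measure.pi (fun _ : Fin m => μ) {S | ∃ A ∈ errorSets H₀ T, hits A S ≤ ε * m ∧
      ε + 2 * √(ε * D) + 4 * D < μ.real A} ≤ ENNReal.ofReal (2 * Real.exp (-L)) := by
  have hm3 : (3 : ℝ) ≤ m := by exact_mod_cast hm
  have hm' : (0 : ℝ) < m := by linarith
  obtain ⟨B', η, hη, hB', hBB', hgap, hexp⟩ := exists_deviation_exponent hm' hε hmD
  have hN : ∀ z : Fin m ⊕ (Fin m × Fin 4) → X × Bool,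
      (traces (errorSets H₀ T) z).card ≤ (5 * m + 1) ^ ((V + 1) * T) := by
    intro z
    have h1 := Finset.card_le_card (traces_mono (errorSets_mono hH₀ T) z)
    have h2 := card_traces_errorSets_le hbin hV T z
    have e : Fintype.card (Fin m ⊕ (Fin m × Fin 4)) = 5 * m := by simp; ring
    rw [e] at h2
    exact h1.trans h2
  refine (measure_exists_deviation_le
    (countable_errorSets (fun h hh => hbin h (hH₀ hh)) hcount T)
    (fun A hA => measurableSet_errorSets (fun h hh => hmeas h (hH₀ hh)) hA) hN hη hB' hBB'
    hgap).trans (ENNReal.ofReal_le_ofReal (mul_le_mul_of_nonneg_left ?_ two_pos.le))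
  set l := Real.log (2 * Real.exp 1 * m) with hl
  have he := Real.exp_one_gt_d9
  have hpos : 0 < 2 * Real.exp 1 * m := by positivity
  have hbase : (5 * m + 1 : ℝ) ≤ 2 * Real.exp 1 * m := by nlinarith
  have hl0 : 0 ≤ l := Real.log_nonneg (by linarith)
  have hNexp : (((5 * m + 1) ^ ((V + 1) * T) : ℕ) : ℝ) ≤ Real.exp ((V + 1) * T * l) := by
    push_cast
    calc (5 * m + 1 : ℝ) ^ ((V + 1) * T) ≤ (2 * Real.exp 1 * m) ^ ((V + 1) * T) := by gcongr
      _ = Real.exp ((V + 1) * T * l) := by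
          rw [← Real.exp_log hpos, ← Real.exp_nat_mul, ← hl]
          push_cast; rfl
  have hV0 : 0 ≤ (V + 1 : ℝ) * l := by positivity
  -- the rounding error `T ≤ q + 1` is a factor of at most `13 / 12`
  have hTq : (V + 1) * T * l ≤ 13 / 12 * q * ((V + 1) * l) := by
    have := mul_le_mul_of_nonneg_right (by linarith : (T : ℝ) ≤ 13 / 12 * q) hV0
    linarith
  calc _ ≤ Real.exp ((V + 1) * T * l) * Real.exp (-(1.15 * (m * D))) := by
        gcongr
    _ = Real.exp ((V + 1) * T * l - 1.15 * (m * D)) := by rw [← Real.exp_add]; rfl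
    _ ≤ Real.exp (-L) := by
        refine Real.exp_le_exp.2 ?_
        rw [hD]
        have h1 : 0 ≤ q * ((V + 1) * l) := by positivity
        have h2 : 12 * L ≤ q * L := mul_le_mul_of_nonneg_right hq hL
        nlinarith

lemma risk_le_one (w : Weighting H) : risk μ w ≤ 1 := by
  by_cases hi : Integrable (fun z : X × Bool => zeroOne (vote w z.1) z.2) μ
  · have := integral_mono hi (integrable_const (1 : ℝ)) fun z => zeroOne_le_one _ _
    simpa [risk] using this
  · rw [risk, integral_undef hi]; exact zero_le_one

end Deviation

end Boosting

open Boosting in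
theorem mainTheorem2 {X : Type*} [MeasurableSpace X]
    -- the source distribution
    (μ : MeasureTheory.Measure (X × Bool)) [MeasureTheory.IsProbabilityMeasure μ]
    -- the class, of VC dimension `V`
    (H : Set (X → ℝ)) (hbin : ∀ h ∈ H, ∀ x, h x = 1 ∨ h x = -1)
    (hmeas : ∀ h ∈ H, Measurable h) (hsep : Boosting.PointwiseSeparable H)
    (V : ℕ) (hV : Boosting.vcDim H = V)
    -- the loss, and separability
    (ℓ : ℝ → ℝ) (β₁ β₂ B₂ : ℝ) (hℓ : Boosting.IsBdsLoss ℓ β₁ β₂ B₂)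
    (hL : Boosting.optSurrogateRisk ℓ H μ = 0)
    -- tolerance, confidence, and the parameters of the algorithm
    (ε δ a ρ : ℝ) (hε : 0 < ε ∧ ε ≤ 1) (hδ : 0 < δ ∧ δ ≤ 1)
    (ha : 0 < a ∧ a < 1) (hρ : 0 < ρ ∧ ρ < 1) :
    0 < Boosting.gam H (ε * β₁ / β₂) μ ∧
    ∀ m : ℕ,
      max (2 / (ε * Boosting.gam H (ε * β₁ / β₂) μ) ^ 2 * Real.log (4 / δ))
          ((24 * B₂ * ℓ 0 / (ρ * β₁ * ε * Boosting.gam H (ε * β₁ / β₂) μ) ^ 2) ^ (1 / a))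
        ≤ (m : ℝ) →
      -- the (outer) probability that some run on an i.i.d. sample violates the bound
      MeasureTheory.Measure.pi (fun _ : Fin m => μ)
        {S | ¬ ∀ w : Boosting.Weighting H, Boosting.IsBoostOutput ℓ B₂ ρ a S w →
          Boosting.risk μ w ≤ ε
            + 2 * √(ε * (((V + 1) * Real.log (2 * Real.exp 1 * m) + Real.log (8 / δ))
                / (m : ℝ) ^ (1 - a)))
            + 4 * (((V + 1) * Real.log (2 * Real.exp 1 * m) + Real.log (8 / δ))
                / (m : ℝ) ^ (1 - a))}
        ≤ ENNReal.ofReal δ := by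
  obtain ⟨hε0, hε1⟩ := hε
  obtain ⟨hδ0, hδ1⟩ := hδ
  obtain ⟨ha0, ha1⟩ := ha
  obtain ⟨hρ0, hρ1⟩ := hρ
  have hβ := hℓ.beta_pos
  have hβ₂ : 0 < β₂ := hβ.trans_le hℓ.beta_le
  have hB := hℓ.smoothness_pos
  have hl0 := hℓ.pos_zero
  have hκ0 : 0 < ε * β₁ / β₂ := by positivity
  have hκ1 : ε * β₁ / β₂ ≤ 1 := by
    rw [div_le_one hβ₂]
    exact (mul_le_of_le_one_left hβ.le hε1).trans hℓ.beta_le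
  have hγ0 : 0 < gam H (ε * β₁ / β₂) μ := gam_pos hbin hmeas hℓ hL hκ0 hκ1
  have hγ1 : gam H (ε * β₁ / β₂) μ ≤ 1 := gam_le_one hbin hmeas hκ0 hκ1
  refine ⟨hγ0, fun m hmax => ?_⟩
  set γ := gam H (ε * β₁ / β₂) μ with hγ
  have hm2 := (le_max_right _ _).trans hmax
  have hm0 : 0 < m := by
    have h1 := (le_max_left _ _).trans hmax
    have h2 : 0 < Real.log (4 / δ) :=
      Real.log_pos (by rw [lt_div_iff₀ hδ0]; linarith)
    have h3 : 0 < 2 / (ε * γ) ^ 2 * Real.log (4 / δ) := by positivity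
    exact_mod_cast h3.trans_le h1
  have hm' : (0 : ℝ) < m := by exact_mod_cast hm0
  set C := (V + 1) * Real.log (2 * Real.exp 1 * m) + Real.log (8 / δ) with hC
  set r := (m : ℝ) ^ (1 - a) with hr
  set q := (m : ℝ) ^ a with hq
  have hr0 : 0 < r := Real.rpow_pos_of_pos hm' _
  have hqr : q * r = m := by
    rw [hq, hr, ← Real.rpow_add hm']; simp
  set K := B₂ * ℓ 0 / β₁ ^ 2 with hK
  have hK0 : 0 < K := by positivity
  have hiter : 24 * B₂ * ℓ 0 / (ρ * β₁ * ε * γ) ^ 2 ≤ q := by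
    have h1 : 0 ≤ 24 * B₂ * ℓ 0 / (ρ * β₁ * ε * γ) ^ 2 := by positivity
    have h2 := Real.rpow_le_rpow (by positivity) hm2 ha0.le
    rwa [← Real.rpow_mul h1, one_div, inv_mul_cancel₀ ha0.ne', Real.rpow_one] at h2
  have hqK : 24 * K ≤ q * (ρ * (ε * γ)) ^ 2 := by
    rw [div_le_iff₀ (by positivity)] at hiter
    have e : 24 * K = 24 * B₂ * ℓ 0 / β₁ ^ 2 := by rw [hK]; ring
    rw [e, div_le_iff₀ (by positivity)]
    linarith
  have hq0 : 0 < q := Real.rpow_pos_of_pos hm' _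
  have hρεγ : (ρ * (ε * γ)) ^ 2 ≤ (ε * γ) ^ 2 := by
    refine pow_le_pow_left₀ (by positivity) (mul_le_of_le_one_left (by positivity) hρ1.le) 2
  have hq12 : 12 ≤ q := by
    -- `2 * K ≥ 1` since the derivative is controlled by the loss at `0`
    have h1 : 1 ≤ 2 * K := by
      have h2 := hℓ.sq_deriv_le 0
      have h3 : β₁ ^ 2 ≤ deriv ℓ 0 ^ 2 :=
        pow_le_pow_left₀ hβ.le (hℓ.deriv_mem_of_nonneg 0 le_rfl).1 2
      have e : 2 * K = 2 * B₂ * ℓ 0 / β₁ ^ 2 := by rw [hK]; ring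
      rw [e, one_le_div (by positivity)]
      linarith
    have h4 : (ε * γ) ^ 2 ≤ 1 := pow_le_one₀ (by positivity) (mul_le_one₀ hε1 hγ0.le hγ1)
    have h5 : q * (ρ * (ε * γ)) ^ 2 ≤ q * 1 :=
      mul_le_mul_of_nonneg_left (hρεγ.trans h4) hq0.le
    linarith
  have hlog8 : Real.log 8 ≤ Real.log (8 / δ) := by
    refine Real.log_le_log (by norm_num) ?_
    rw [le_div_iff₀ hδ0]; linarith
  have hlog2 := Real.log_two_gt_d9
  have hlog8' : Real.log 8 = 3 * Real.log 2 := by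
    rw [show (8 : ℝ) = 2 ^ 3 by norm_num, Real.log_pow]; norm_num
  have hlogm : Real.log (2 * Real.exp 1 * m) = Real.log 2 + 1 + Real.log m := by
    rw [Real.log_mul (by positivity) hm'.ne', Real.log_mul two_ne_zero (Real.exp_pos 1).ne',
      Real.log_exp]
  have hm1 : (1 : ℝ) ≤ m := by exact_mod_cast hm0
  have hlogm0 : 0 ≤ Real.log m := Real.log_nonneg hm1
  have hl : 0 ≤ Real.log (2 * Real.exp 1 * m) := by rw [hlogm]; linarith
  have hVl : Real.log (2 * Real.exp 1 * m) ≤ (V + 1) * Real.log (2 * Real.exp 1 * m) :=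
    le_mul_of_one_le_left hl (by linarith [(Nat.cast_nonneg V : (0 : ℝ) ≤ V)])
  -- `log 8 + log 2 + 1 ≥ 3.7`
  have hClow : 3.7 + Real.log m ≤ C := by
    rw [hC]; rw [hlogm] at hVl ⊢; linarith
  have hC0 : 0 < C := by linarith
  rcases le_or_gt r (4 * C) with htriv | hbig
  · -- the bound exceeds `1`
    refine le_trans (le_of_eq ?_) (zero_le (a := ENNReal.ofReal δ))
    convert measure_empty (μ := Measure.pi fun _ : Fin m => μ)
    refine Set.eq_empty_iff_forall_notMem.2 fun S hS => hS fun w _ => ?_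
    have h1 : 1 ≤ 4 * (C / r) := by rw [← mul_div_assoc, one_le_div hr0]; exact htriv
    have h2 : 0 ≤ √(ε * (C / r)) := Real.sqrt_nonneg _
    linarith [risk_le_one (μ := μ) w]
  set L := Real.log (8 / δ) with hLdef
  have hL0 : 0 < L := by linarith
  have hexpL : Real.exp (-L) = δ / 8 := by
    rw [Real.exp_neg, hLdef, Real.exp_log (by positivity), inv_div]
  have hmbig : 48 * C ≤ m := by
    rw [← hqr]
    have := mul_le_mul hq12 hbig.le (by positivity) hq0.le
    linarith
  have hmL : 96 * K * L ≤ m * (ε * γ) ^ 2 := by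
    have h1 : L ≤ C := by rw [hC]; linarith
    have h2 : 24 * K ≤ q * (ε * γ) ^ 2 :=
      hqK.trans (mul_le_mul_of_nonneg_left hρεγ hq0.le)
    have h3 : 4 * L ≤ r := by linarith
    have h4 := mul_le_mul h2 h3 (by positivity) (by positivity)
    rw [← hqr]
    linarith
  have hm3 : 3 ≤ m := by
    have : (3 : ℝ) ≤ m := by linarith
    exact_mod_cast this
  have hmD : m * (C / r) = q * C := by rw [← hqr]; field_simp
  have hmD50 : 50 ≤ m * (C / r) := by
    rw [hmD]
    have h1 : Real.log 64 ≤ Real.log m := Real.log_le_log (by norm_num) (by linarith)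
    have h2 : Real.log 64 = 6 * Real.log 2 := by
      rw [show (64 : ℝ) = 2 ^ 6 by norm_num, Real.log_pow]; norm_num
    have h3 := mul_le_mul hq12 (by linarith : (7 : ℝ) ≤ C) (by norm_num) hq0.le
    linarith
  -- the two exceptional events have probability at most `δ / 8` and `2 * (δ / 8)`
  obtain ⟨H₀, hH₀, hcount, happrox⟩ := hsep
  have hev1 := measure_not_large_slope_le (μ := μ) (m := m) hbin hmeas hℓ hε0 hε1 hγ0 hγ hm0 hL0
    hmL
  have hT : ((⌈q⌉₊ : ℕ) : ℝ) ≤ q + 1 := (Nat.ceil_lt_add_one hq0.le).le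
  have hev2 := measure_errorSets_deviation_le (μ := μ) hbin hmeas hV hH₀ hcount hm3 hε0 hq12 hT
    hL0.le hmD50 hmD
  refine (measure_mono (fun S hS => ?_)).trans ((measure_union_le _ _).trans
    ((add_le_add hev1 hev2).trans ?_))
  · by_contra hc
    rw [Set.mem_union, not_or] at hc
    obtain ⟨hc1, hc2⟩ := hc
    refine hS fun w hw => ?_
    by_contra hrisk
    push Not at hrisk
    have hslope := not_not.1 hc1
    have hemp := hw.empRisk_le hbin hℓ hm0 hρ0 hε0 hε1 hγ0 hiter hslope
    obtain ⟨g, c, hg, hvote⟩ := hw.exists_vote_eq hbin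
    exact hc2 (exists_errorSet_of_vote hbin hmeas hH₀ happrox hm0 hg hvote hemp hrisk)
  · rw [← ENNReal.ofReal_add (by positivity) (by positivity), hexpL]
    exact ENNReal.ofReal_le_ofReal (by linarith)
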